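/- Let $\Gamma$ be a connected metric graph with finitely many vertices and finitely many edges, each edge being either a segment of finite positive length joining two (possibly equal) vertices or a half-line attached to one vertex. For $k=1,2$ let $H^k(\Gamma)$ be the space of complex functions on $\Gamma$ that are component-wise in $H^k$. Let $H^1_\Gamma$ be the space of $U\in H^1(\Gamma)$ that are continuous at the vertices, and $H^2_\Gamma$ the space of $U\in H^2(\Gamma)$ that satisfy the Neumann–Kirchhoff conditions: $U$ is continuous at the vertices, and at each vertex the sum of the outgoing derivatives of $U$ is zero. Put $$\mathcal Q(U)=\int_\Gamma |U|^2\,dx,\qquad \mathcal E(U)=\int_\Gamma\left(|\partial_xU|^2-|U|^4\right)dx .$$ Let $q>0$ and let $\Phi\in H^1_\Gamma$ be a ground state of mass $q$, that is, $\mathcal Q(\Phi)=q$ and $\mathcal E(\Phi)=\inf\{\mathcal E(U): U\in H^1_\Gamma,\ \mathcal Q(U)=q\}$. Then: 1. $\Phi$ is real and positive up to a non-zero factor: there is $c\in\mathbb C\setminus\{0\}$ such that $c\,\Phi$ is real and strictly positive everywhere on $\Gamma$, vertices included. 2. $\Phi\in H^2_\Gamma$, and $\Phi$ solves the stationary NLS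 equation $-\Delta\Phi-2|\Phi|^2\Phi=\Lambda\Phi$ for some $\Lambda\in\mathbb R$. 3. $\Phi$ is non-oscillatory on every edge on which it is not constant: if $e$ is an open edge and $\Phi$ is not constant on $e$, then $\#\{x\in e:\Phi(x)=\phi\}\le 2$ for every $\phi\in\mathbb C$. -/

import Mathlib

open MeasureTheory Set
open scoped ContDiff

/-! ### Sobolev spaces on an open set of the line, through weak derivatives -/

/-- `g` is a weak derivative of `u` on the open set `I`. -/
def HasWeakDeriv (I : Set ℝ) (u g : ℝ → ℂ) : Prop :=
  LocallyIntegrableOn u I volume ∧ LocallyIntegrableOn g I volume ∧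
    ∀ η : ℝ → ℝ, ContDiff ℝ ∞ η → HasCompactSupport η → tsupport η ⊆ I →
      ∫ x in I, deriv η x • u x = -∫ x in I, η x • g x

/-- `u ∈ H^k(I)`: `u` and its weak derivatives up to order `k` are in `L²(I)`. -/
def MemSobolev (I : Set ℝ) : ℕ → (ℝ → ℂ) → Prop
  | 0, u => MemLp u 2 (volume.restrict I)
  | k + 1, u => MemLp u 2 (volume.restrict I) ∧ ∃ g, HasWeakDeriv I u g ∧ MemSobolev I k g

open Classical in
/-- The weak derivative of `u` on `I` (unique up to a null set of `I`; `0` if there is none). -/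
noncomputable def weakDeriv (I : Set ℝ) (u : ℝ → ℂ) : ℝ → ℂ :=
  if h : ∃ g, HasWeakDeriv I u g then h.choose else 0

/-! ### Metric graphs -/

/-- A metric graph with vertices `V`, edges of finite length `E` and half-lines `H`. An edge `e : E`
is a copy of `[0, len e]` running from `src e` to `tgt e`; a half-line `h : H` is a copy of `[0, ∞)`
attached at `root h`. Loops and multiple edges are allowed. -/
structure MetricGraph (V E H : Type*) where
  src : E → V
  tgt : E → V
  len : E → ℝ
  len_pos : ∀ e, 0 < len e
  root : H → V

namespace MetricGraph

variable {V E H : Type*} (Γ : MetricGraph V E H)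

/-- The open edge, as a subset of the line. -/
def openEdge : E ⊕ H → Set ℝ
  | .inl e => Ioo 0 (Γ.len e)
  | .inr _ => Ioi 0

/-- The edge together with its end-vertices. -/
def closedEdge : E ⊕ H → Set ℝ
  | .inl e => Icc 0 (Γ.len e)
  | .inr _ => Ici 0

/-- The graph is connected. (A half-line has a single vertex and does not join two vertices.) -/
def IsConnected : Prop :=
  (SimpleGraph.fromRel fun v w => ∃ e, Γ.src e = v ∧ Γ.tgt e = w).Connected

/-! A function on the graph is a family `U : E ⊕ H → ℝ → ℂ`, where only the values of `U e` on
`closedEdge e` matter. -/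

/-- `U` is continuous on the graph: on each edge up to its end-vertices, with one common value
at each vertex. -/
def IsContinuous (U : E ⊕ H → ℝ → ℂ) : Prop :=
  (∀ e, ContinuousOn (U e) (Γ.closedEdge e)) ∧
    ∃ p : V → ℂ, (∀ e : E, U (.inl e) 0 = p (Γ.src e) ∧ U (.inl e) (Γ.len e) = p (Γ.tgt e)) ∧
      ∀ h : H, U (.inr h) 0 = p (Γ.root h)

/-- `U ∈ H¹_Γ`: component-wise `H¹` (with its continuous representative), continuous at vertices. -/
def MemH1 (U : E ⊕ H → ℝ → ℂ) : Prop :=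
  (∀ e, MemSobolev (Γ.openEdge e) 1 (U e)) ∧ Γ.IsContinuous U

open Classical in
/-- The sum of the outgoing derivatives of `U` at the vertex `v` (a loop contributes twice). For
component-wise `H²` functions that are continuous up to the vertices these one-sided derivatives
exist. -/
noncomputable def outgoingSum [Fintype E] [Fintype H] (U : E ⊕ H → ℝ → ℂ) (v : V) : ℂ :=
  (∑ e : E, if Γ.src e = v then derivWithin (U (.inl e)) (Γ.closedEdge (.inl e)) 0 else 0) +
  (∑ e : E, if Γ.tgt e = v then
    -derivWithin (U (.inl e)) (Γ.closedEdge (.inl e)) (Γ.len e) else 0) +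
  ∑ h : H, if Γ.root h = v then derivWithin (U (.inr h)) (Γ.closedEdge (.inr h)) 0 else 0

/-- `U ∈ H²_Γ`: component-wise `H²` with Neumann–Kirchhoff conditions at the vertices. -/
def MemH2 [Fintype E] [Fintype H] (U : E ⊕ H → ℝ → ℂ) : Prop :=
  (∀ e, MemSobolev (Γ.openEdge e) 2 (U e)) ∧ Γ.IsContinuous U ∧ ∀ v, Γ.outgoingSum U v = 0

/-- The mass `∫ |U|²`. -/
noncomputable def mass [Fintype E] [Fintype H] (U : E ⊕ H → ℝ → ℂ) : ℝ :=
  ∑ e, ∫ x in Γ.openEdge e, ‖U e x‖ ^ 2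

/-- The energy `∫ (|∂ₓU|² - |U|⁴)`. -/
noncomputable def energy [Fintype E] [Fintype H] (U : E ⊕ H → ℝ → ℂ) : ℝ :=
  ∑ e, ∫ x in Γ.openEdge e, (‖weakDeriv (Γ.openEdge e) (U e) x‖ ^ 2 - ‖U e x‖ ^ 4)

/-- `Φ` is a ground state of mass `q`: it minimizes the energy over all `U ∈ H¹_Γ` of mass `q`. -/
def IsGroundState [Fintype E] [Fintype H] (q : ℝ) (Φ : E ⊕ H → ℝ → ℂ) : Prop :=
  Γ.MemH1 Φ ∧ Γ.mass Φ = q ∧ ∀ U, Γ.MemH1 U → Γ.mass U = q → Γ.energy Φ ≤ Γ.energy U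

/-- The stationary NLS equation `-ΔΦ - 2|Φ|²Φ = ΛΦ`, as an identity in `L²` on each edge. -/
def SolvesStationaryNLS (Λ : ℝ) (Φ : E ⊕ H → ℝ → ℂ) : Prop :=
  ∀ e, ∀ᵐ x ∂volume.restrict (Γ.openEdge e),
    -weakDeriv (Γ.openEdge e) (weakDeriv (Γ.openEdge e) (Φ e)) x
      - 2 * (‖Φ e x‖ ^ 2 : ℝ) * Φ e x = Λ * Φ e x

end MetricGraph

/-! ### Weak derivatives on the line -/

/-! Regularity. For any variation `W`, the function `Φ + tW` rescaled to mass `q` competes with `Φ`.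
After clearing denominators the energy inequality becomes polynomial in `t`, with equality at `t =
0`, and its first-order condition is the weak Euler–Lagrange equation with multiplier `Λ = (∫|Φ'|² -
2∫|Φ|⁴)/q`. Variations inside one edge give the equation there: `Φ'` has a continuous weak
derivative, so `Φ` is `C²` up to the vertices. Variations that are non-zero at a single vertex then
give the Kirchhoff condition as a natural boundary condition (`exists_isClassicalSolution`).

Positivity. Replacing `Re Φ` by `|Re Φ|` changes neither `|Φ|` nor `|Φ'|`, hence gives a ground
state with the same multiplier. Both functions therefore solve the same linear equation, with
potential `2|Φ|² + Λ`, and `|Re Φ| + Re Φ` is a non-negative Kirchhoff solution of it. By the strong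
maximum principle (`strong_maximum_principle`) either `Re Φ ≤ 0` everywhere or `Re Φ > 0`
everywhere. Rotate `Φ` to be positive at one point: the real parts of `iΦ` and `-iΦ` vanish there,
so both are `≤ 0` everywhere. Thus `Im Φ = 0`, and `Re Φ > 0` is the only alternative left.

Non-oscillation. If `Φ(a) = Φ(b)` inside an edge, reversing `Φ` on `[a, b]` gives another ground
state. It must be `C¹` at `a`, so `Φ'(a) = -Φ'(b)` (`deriv_eq_neg_deriv`). Three points with one
value then have pairwise opposite slopes, hence zero slopes, and by the equation the same second
derivative. If this is zero, `Φ` is constant on the edge by uniqueness for the Cauchy problem.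
Otherwise these are strict local extrema of one kind, and a nearby level is again taken three times,
now with a non-zero slope: a contradiction (`false_of_two_strict_max`). -/

theorem intervalIntegrable_of_locallyIntegrable {F : Type*} [NormedAddCommGroup F] {g : ℝ → F}
    (hg : LocallyIntegrable g volume) (a b : ℝ) : IntervalIntegrable g volume a b :=
  intervalIntegrable_iff.mpr <|
    (hg.integrableOn_isCompact isCompact_uIcc).mono_set uIoc_subset_uIcc

theorem exists_support_subset_Ioo {η : ℝ → ℝ} (hη : HasCompactSupport η) :
    ∃ R : ℝ, 0 < R ∧ tsupport η ⊆ Ioo (-R) R := by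
  obtain ⟨R, hR, h⟩ := hη.isCompact.isBounded.subset_ball_lt 0 0
  exact ⟨R, hR, by simpa [Real.ball_eq_Ioo] using h⟩

/-- Both factors are absolutely continuous on an interval `[-R, R]` whose interior contains the
support of `η`, so integration by parts leaves no boundary terms. Lebesgue's differentiation theorem
identifies the derivative of the primitive with `g` almost everywhere. -/
theorem integral_deriv_mul_primitive_real {g : ℝ → ℝ} (hg : LocallyIntegrable g volume)
    {η : ℝ → ℝ} (hη : ContDiff ℝ ∞ η) (hc : HasCompactSupport η) :
    ∫ x, deriv η x * (∫ t in (0 : ℝ)..x, g t) = -∫ x, η x * g x := by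
  obtain ⟨R, hR, hsupp⟩ := exists_support_subset_Ioo hc
  have hsub : Ioo (-R) R ⊆ Ioc (-R) R := Ioo_subset_Ioc_self
  have h1 : Function.support (fun x => deriv η x * (∫ t in (0 : ℝ)..x, g t)) ⊆ Ioc (-R) R :=
    fun x hx => hsub (hsupp (support_deriv_subset (left_ne_zero_of_mul hx)))
  have h2 : Function.support (fun x => η x * g x) ⊆ Ioc (-R) R :=
    fun x hx => hsub (hsupp (subset_tsupport _ (left_ne_zero_of_mul hx)))
  rw [← intervalIntegral.integral_eq_integral_of_support_subset h1,
    ← intervalIntegral.integral_eq_integral_of_support_subset h2]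
  have hF : AbsolutelyContinuousOnInterval (fun x => ∫ t in (0 : ℝ)..x, g t) (-R) R :=
    (intervalIntegrable_of_locallyIntegrable hg _ _).absolutelyContinuousOnInterval_intervalIntegral
      (by rw [uIcc_of_le (by linarith)]; constructor <;> linarith)
  have hA : AbsolutelyContinuousOnInterval η (-R) R :=
    (hη.of_le (by exact_mod_cast le_top)).contDiffOn.absolutelyContinuousOnInterval
  have h0 : η R = 0 := image_eq_zero_of_notMem_tsupport fun h => lt_irrefl _ (hsupp h).2
  have h0' : η (-R) = 0 := image_eq_zero_of_notMem_tsupport fun h => lt_irrefl _ (hsupp h).1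
  have := hF.integral_mul_deriv_eq_deriv_mul hA
  simp only [h0, h0', mul_zero, sub_zero, zero_sub] at this
  simp_rw [mul_comm (deriv η _), this]
  congr 1
  apply intervalIntegral.integral_congr_ae
  filter_upwards [LocallyIntegrable.ae_hasDerivAt_integral hg] with x hx _
  rw [(hx 0).deriv, mul_comm]

/-- Reduces to the real case by applying the real and imaginary parts as continuous linear
functionals. -/
theorem integral_deriv_smul_primitive {g : ℝ → ℂ} (hg : LocallyIntegrable g volume)
    {η : ℝ → ℝ} (hη : ContDiff ℝ ∞ η) (hc : HasCompactSupport η) :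
    ∫ x, deriv η x • (∫ t in (0 : ℝ)..x, g t) = -∫ x, η x • g x := by
  have hint (x : ℝ) := intervalIntegrable_of_locallyIntegrable hg 0 x
  have hcont : Continuous fun x => ∫ t in (0 : ℝ)..x, g t :=
    intervalIntegral.continuous_primitive (intervalIntegrable_of_locallyIntegrable hg) 0
  have hη' : Continuous (deriv η) := hη.continuous_deriv (by exact_mod_cast le_top)
  have hI1 : Integrable fun x => deriv η x • (∫ t in (0 : ℝ)..x, g t) :=
    (hη'.smul hcont).integrable_of_hasCompactSupport (hc.deriv.smul_right)
  have hI2 : Integrable fun x => η x • g x :=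
    hg.integrable_smul_left_of_hasCompactSupport hη.continuous hc
  have key (L : ℂ →L[ℝ] ℝ) :
      L (∫ x, deriv η x • (∫ t in (0 : ℝ)..x, g t)) = L (-∫ x, η x • g x) := by
    have hre : LocallyIntegrable (fun x => L (g x)) volume := fun x => by
      obtain ⟨s, hs, h⟩ := hg x
      exact ⟨s, hs, L.integrable_comp h⟩
    rw [map_neg, ← L.integral_comp_comm hI1, ← L.integral_comp_comm hI2]
    simp only [map_smul, smul_eq_mul]
    rw [← integral_deriv_mul_primitive_real hre hη hc]
    congr 1 with x
    rw [L.intervalIntegral_comp_comm (hint x)]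
  exact Complex.ext (key Complex.reCLM) (key Complex.imCLM)

theorem setIntegral_smul_eq_integral {I : Set ℝ} {η : ℝ → ℝ} (hI : tsupport η ⊆ I) (u : ℝ → ℂ) :
    ∫ x in I, η x • u x = ∫ x, η x • u x :=
  setIntegral_eq_integral_of_forall_compl_eq_zero fun x hx => by
    rw [image_eq_zero_of_notMem_tsupport fun h => hx (hI h), zero_smul]

theorem setIntegral_deriv_smul_eq_integral {I : Set ℝ} {η : ℝ → ℝ} (hI : tsupport η ⊆ I)
    (u : ℝ → ℂ) : ∫ x in I, deriv η x • u x = ∫ x, deriv η x • u x :=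
  setIntegral_eq_integral_of_forall_compl_eq_zero fun x hx => by
    rw [Function.notMem_support.mp fun h => hx (hI (support_deriv_subset h)), zero_smul]

theorem integrable_smul_of_tsupport_subset {I : Set ℝ} {η : ℝ → ℝ} (hη : Continuous η)
    (hc : HasCompactSupport η) (hI : tsupport η ⊆ I) {u : ℝ → ℂ}
    (hu : LocallyIntegrableOn u I volume) : Integrable fun x => η x • u x := by
  have := (hu.integrableOn_compact_subset hI hc.isCompact).continuousOn_smul hη.continuousOn
    hc.isCompact
  refine (integrableOn_iff_integrable_of_support_subset fun x hx => ?_).mp this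
  exact subset_tsupport _ (left_ne_zero_of_smul hx)

theorem integrable_deriv_smul_of_tsupport_subset {I : Set ℝ} {η : ℝ → ℝ} (hη : ContDiff ℝ ∞ η)
    (hc : HasCompactSupport η) (hI : tsupport η ⊆ I) {u : ℝ → ℂ}
    (hu : LocallyIntegrableOn u I volume) : Integrable fun x => deriv η x • u x :=
  integrable_smul_of_tsupport_subset (hη.continuous_deriv (by exact_mod_cast le_top)) hc.deriv
    ((closure_minimal support_deriv_subset (isClosed_tsupport η)).trans hI) hu

theorem memLp_two_locallyIntegrableOn {I : Set ℝ} {u : ℝ → ℂ}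
    (hu : MemLp u 2 (volume.restrict I)) : LocallyIntegrableOn u I volume := by
  exact locallyIntegrableOn_of_locallyIntegrable_restrict (hu.locallyIntegrable (by norm_num))

namespace HasWeakDeriv

variable {I : Set ℝ} {u v g h : ℝ → ℂ}

/-- The primitive of a locally integrable function has it as weak derivative. -/
theorem of_primitive (hI : IsOpen I) (hg : LocallyIntegrable g volume) (d : ℂ)
    (hu : ∀ x ∈ I, u x = d + ∫ t in (0 : ℝ)..x, g t) : HasWeakDeriv I u g := by
  have hcont : Continuous fun x => d + ∫ t in (0 : ℝ)..x, g t :=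
    continuous_const.add
      (intervalIntegral.continuous_primitive (intervalIntegrable_of_locallyIntegrable hg) 0)
  refine ⟨?_, hg.locallyIntegrableOn _, fun η hη hc hs => ?_⟩
  · exact (hcont.continuousOn.congr hu).locallyIntegrableOn hI.measurableSet
  · rw [setIntegral_smul_eq_integral hs, ← integral_deriv_smul_primitive hg hη hc]
    rw [setIntegral_congr_fun hI.measurableSet
      (g := fun x => deriv η x • (d + ∫ t in (0 : ℝ)..x, g t))
      (fun x hx => by simp only [hu x hx]), setIntegral_deriv_smul_eq_integral hs]
    simp only [smul_add]
    have hη' : Continuous (deriv η) := hη.continuous_deriv (by exact_mod_cast le_top)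
    rw [integral_add]
    · have : ∫ x, deriv η x = 0 :=
        integral_eq_zero_of_hasDerivAt_of_integrable
          (fun x => (hη.differentiable (by simp)).differentiableAt.hasDerivAt)
          (hη'.integrable_of_hasCompactSupport hc.deriv)
          (hη.continuous.integrable_of_hasCompactSupport hc)
      rw [integral_smul_const, this, zero_smul, zero_add]
    · exact (hη'.smul continuous_const).integrable_of_hasCompactSupport hc.deriv.smul_right
    · refine (hη'.smul ?_).integrable_of_hasCompactSupport hc.deriv.smul_right
      exact intervalIntegral.continuous_primitive (intervalIntegrable_of_locallyIntegrable hg) 0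

theorem congr_ae (hI : IsOpen I) (H : HasWeakDeriv I u g)
    (hu : ∀ᵐ x ∂volume.restrict I, u x = v x) (hg : ∀ᵐ x ∂volume.restrict I, g x = h x) :
    HasWeakDeriv I v h := by
  obtain ⟨h1, h2, h3⟩ := H
  refine ⟨?_, ?_, fun η hη hc hs => ?_⟩
  · rw [locallyIntegrableOn_iff hI.isLocallyClosed] at h1 ⊢
    exact fun k hk hkc => (h1 k hk hkc).congr_fun_ae (ae_restrict_of_ae_restrict_of_subset hk hu)
  · rw [locallyIntegrableOn_iff hI.isLocallyClosed] at h2 ⊢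
    exact fun k hk hkc => (h2 k hk hkc).congr_fun_ae (ae_restrict_of_ae_restrict_of_subset hk hg)
  · rw [← integral_congr_ae (hg.mono fun x hx => show η x • g x = η x • h x by rw [hx]),
      ← h3 η hη hc hs]
    exact (integral_congr_ae
      (hu.mono fun x hx => show deriv η x • u x = deriv η x • v x by rw [hx])).symm

/-- The difference is orthogonal to all test functions; this is the fundamental lemma of the
calculus of variations. -/
theorem ae_unique (hI : IsOpen I) (hg : HasWeakDeriv I u g) (hh : HasWeakDeriv I u h) :
    ∀ᵐ x ∂volume.restrict I, g x = h x := by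
  rw [ae_restrict_iff' hI.measurableSet]
  have := hI.ae_eq_zero_of_integral_contDiff_smul_eq_zero (hg.2.1.sub hh.2.1) fun η hη hc hs => by
    simp only [Pi.sub_apply, smul_sub]
    rw [integral_sub (integrable_smul_of_tsupport_subset hη.continuous hc hs hg.2.1)
      (integrable_smul_of_tsupport_subset hη.continuous hc hs hh.2.1),
      ← setIntegral_smul_eq_integral hs, ← setIntegral_smul_eq_integral hs,
      ← neg_inj, neg_sub, sub_eq_neg_add, neg_zero, ← hg.2.2 η hη hc hs, hh.2.2 η hη hc hs]
    simp
  filter_upwards [this] with x hx hxI using sub_eq_zero.mp (hx hxI)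

theorem weakDeriv_ae_eq (hI : IsOpen I) (hg : HasWeakDeriv I u g) :
    ∀ᵐ x ∂volume.restrict I, weakDeriv I u x = g x := by
  have hex : ∃ g, HasWeakDeriv I u g := ⟨g, hg⟩
  rw [weakDeriv, dif_pos hex]
  exact ae_unique hI hex.choose_spec hg

theorem add (hu : HasWeakDeriv I u g) (hv : HasWeakDeriv I v h) :
    HasWeakDeriv I (fun x => u x + v x) (fun x => g x + h x) := by
  refine ⟨hu.1.add hv.1, hu.2.1.add hv.2.1, fun η hη hc hs => ?_⟩
  simp only [smul_add]
  rw [integral_add, integral_add, hu.2.2 η hη hc hs, hv.2.2 η hη hc hs, neg_add]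
  · exact (integrable_smul_of_tsupport_subset hη.continuous hc hs hu.2.1).restrict
  · exact (integrable_smul_of_tsupport_subset hη.continuous hc hs hv.2.1).restrict
  · exact (integrable_deriv_smul_of_tsupport_subset hη hc hs hu.1).restrict
  · exact (integrable_deriv_smul_of_tsupport_subset hη hc hs hv.1).restrict

theorem const_mul (c : ℂ) (hu : HasWeakDeriv I u g) :
    HasWeakDeriv I (fun x => c * u x) (fun x => c * g x) := by
  refine ⟨hu.1.smul c, hu.2.1.smul c, fun η hη hc hs => ?_⟩
  simp only [← mul_smul_comm]
  rw [integral_const_mul, integral_const_mul, hu.2.2 η hη hc hs, mul_neg]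

/-- A function with vanishing weak derivative is a.e. constant. -/
theorem ae_const_of_zero (hI : IsOpen I) (hoc : I.OrdConnected) (hne : I.Nonempty)
    (hu : HasWeakDeriv I u 0) : ∃ c, ∀ᵐ x ∂volume.restrict I, u x = c := by
  obtain ⟨x₀, hx₀⟩ := hne
  obtain ⟨ε, hε, hball⟩ := Metric.isOpen_iff.mp hI x₀ hx₀
  let b : ContDiffBump x₀ := ⟨ε / 4, ε / 2, by positivity, by linarith⟩
  set η₀ : ℝ → ℝ := b.normed volume with hη₀
  have hη₀s : ContDiff ℝ ∞ η₀ := b.contDiff_normed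
  have hη₀c : HasCompactSupport η₀ := b.hasCompactSupport_normed
  have hη₀I : tsupport η₀ ⊆ I := by
    rw [hη₀, b.tsupport_normed_eq]
    exact (Metric.closedBall_subset_ball (by simp only [b]; linarith)).trans hball
  have hη₀1 : ∫ x, η₀ x = 1 := b.integral_normed
  set c : ℂ := ∫ x, η₀ x • u x with hcdef
  refine ⟨c, ?_⟩
  rw [ae_restrict_iff' hI.measurableSet]
  have hconst : LocallyIntegrableOn (fun _ : ℝ => c) I volume :=
    (locallyIntegrable_const c).locallyIntegrableOn I
  have := hI.ae_eq_zero_of_integral_contDiff_smul_eq_zero (hu.1.sub hconst) fun η hη hc hs => ?_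
  · filter_upwards [this] with x hx hxI using sub_eq_zero.mp (hx hxI)
  -- Subtracting `m • η₀` from `η` leaves a function `ζ` of zero mean, which is the derivative of a
  -- test function `ψ`. Testing with `ψ` gives `∫ η u = m c`, that is, `u - c` is orthogonal to `η`.
  set m : ℝ := ∫ x, η x with hm
  let ζ : ℝ → ℝ := fun x => η x - m * η₀ x
  have hζs : ContDiff ℝ ∞ ζ := hη.sub (contDiff_const.mul hη₀s)
  have hηi : Integrable η := hη.continuous.integrable_of_hasCompactSupport hc
  have hη₀i : Integrable η₀ := hη₀s.continuous.integrable_of_hasCompactSupport hη₀c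
  have hζ0 : ∫ x, ζ x = 0 := by
    rw [integral_sub hηi (hη₀i.const_mul m), integral_const_mul, hη₀1]; simp [hm]
  obtain ⟨K, hK, hKI, hKsub⟩ : ∃ K, IsCompact K ∧ K ⊆ I ∧ ∀ x, x ∉ K → ζ x = 0 := by
    refine ⟨tsupport η ∪ tsupport η₀, hc.isCompact.union hη₀c.isCompact, union_subset hs hη₀I,
      fun x hx => ?_⟩
    simp only [mem_union, not_or] at hx
    simp [ζ, image_eq_zero_of_notMem_tsupport hx.1, image_eq_zero_of_notMem_tsupport hx.2]
  -- The convex hull of the supports stays in `I` by order-connectedness. The point `x₀` is inserted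
  -- only to have a non-empty compact set.
  obtain ⟨a, a', haI, hζa⟩ : ∃ a a', Icc a a' ⊆ I ∧ ∀ x, x ∉ Icc a a' → ζ x = 0 := by
    have hKn : (insert x₀ K).Nonempty := ⟨x₀, mem_insert _ _⟩
    have hKc : IsCompact (insert x₀ K) := hK.insert x₀
    have hsub : insert x₀ K ⊆ I := insert_subset hx₀ hKI
    obtain ⟨p, hp, hp'⟩ := hKc.exists_isLeast hKn
    obtain ⟨r, hr, hr'⟩ := hKc.exists_isGreatest hKn
    refine ⟨p, r, hoc.out (hsub hp) (hsub hr), fun x hx => hKsub x fun hxK => hx ?_⟩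
    exact ⟨hp' (mem_insert_of_mem _ hxK), hr' (mem_insert_of_mem _ hxK)⟩
  have hζi : ∀ x y, IntervalIntegrable ζ volume x y := fun x y =>
    hζs.continuous.intervalIntegrable x y
  let ψ : ℝ → ℝ := fun x => ∫ t in a..x, ζ t
  have hψd : ∀ x, HasDerivAt ψ (ζ x) x := fun x =>
    intervalIntegral.integral_hasDerivAt_right (hζi _ _)
      (hζs.continuous.stronglyMeasurableAtFilter _ _) hζs.continuous.continuousAt
  have hψ' : deriv ψ = ζ := funext fun x => (hψd x).deriv
  have hψs : ContDiff ℝ ∞ ψ := by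
    rw [contDiff_infty_iff_deriv, hψ']
    exact ⟨fun x => (hψd x).differentiableAt, hζs⟩
  have hψ0 : ∀ x, x ∉ Icc a a' → ψ x = 0 := by
    intro x hx
    rcases lt_or_ge x a with hxa | hxa
    · simp only [ψ]
      rw [intervalIntegral.integral_of_ge hxa.le, ← integral_Ico_eq_integral_Ioc,
        setIntegral_eq_zero_of_forall_eq_zero, neg_zero]
      exact fun t ht => hζa t fun h => (h.1.trans_lt ht.2).false
    · have hxa' : a' < x := by by_contra h; exact hx ⟨hxa, not_lt.mp h⟩
      simp only [ψ]
      rw [intervalIntegral.integral_of_le hxa, ← integral_Icc_eq_integral_Ioc,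
        setIntegral_eq_integral_of_forall_compl_eq_zero, hζ0]
      exact fun t ht => hζa t fun h => ht ⟨h.1, h.2.trans hxa'.le⟩
  have hψsub : tsupport ψ ⊆ Icc a a' :=
    closure_minimal (fun x hx => by_contra fun h => hx (hψ0 x h)) isClosed_Icc
  have hψc : HasCompactSupport ψ := isCompact_Icc.of_isClosed_subset (isClosed_tsupport _) hψsub
  have h0 := hu.2.2 ψ hψs hψc (hψsub.trans haI)
  simp only [Pi.zero_apply, smul_zero, integral_zero, neg_zero] at h0
  rw [setIntegral_deriv_smul_eq_integral (hψsub.trans haI), hψ'] at h0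
  have hi1 := integrable_smul_of_tsupport_subset hη.continuous hc hs hu.1
  have hi2 := integrable_smul_of_tsupport_subset hη₀s.continuous hη₀c hη₀I hu.1
  simp only [ζ, sub_smul, mul_smul] at h0
  have hi3 : Integrable fun x => m • η₀ x • u x := hi2.smul m
  rw [integral_sub hi1 hi3, integral_smul, ← hcdef, sub_eq_zero] at h0
  simp only [Pi.sub_apply, smul_sub]
  rw [integral_sub hi1 (hηi.smul_const c), integral_smul_const, h0, sub_self]

/-- A function with a locally integrable weak derivative is a.e. a primitive of it. -/
theorem ae_eq_primitive (hI : IsOpen I) (hoc : I.OrdConnected) (hne : I.Nonempty)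
    (H : HasWeakDeriv I u g) (hg : LocallyIntegrable g volume) :
    ∃ d, ∀ᵐ x ∂volume.restrict I, u x = d + ∫ t in (0 : ℝ)..x, g t := by
  have H1 := of_primitive hI hg 0 (u := fun x => 0 + ∫ t in (0 : ℝ)..x, g t) fun _ _ => rfl
  have H2 := H.add (H1.const_mul (-1))
  obtain ⟨d, hd⟩ := ae_const_of_zero hI hoc hne
    (H2.congr_ae hI (v := fun x => u x + -1 * (0 + ∫ t in (0 : ℝ)..x, g t)) (h := 0)
      (.of_forall fun _ => rfl) (.of_forall fun x => by simp))
  refine ⟨d, hd.mono fun x hx => ?_⟩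
  rw [← hx]; ring

theorem eqOn_of_ae_eq {u v : ℝ → ℂ} {I J : Set ℝ} (hI : IsOpen I) (hIJ : I ⊆ J)
    (hJI : J ⊆ closure I) (hu : ContinuousOn u J) (hv : ContinuousOn v J)
    (h : ∀ᵐ x ∂volume.restrict I, u x = v x) : EqOn u v J :=
  EqOn.of_subset_closure
    (Measure.eqOn_open_of_ae_eq h hI (hu.mono hIJ) (hv.mono hIJ)) hu hv hIJ hJI

/-- The almost everywhere identity extends up to the end-points, both sides being continuous on `J ⊆
closure I`. -/
theorem eqOn_primitive {J : Set ℝ} (hI : IsOpen I) (hoc : I.OrdConnected) (hne : I.Nonempty)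
    (hIJ : I ⊆ J) (hJI : J ⊆ closure I) (hu : ContinuousOn u J)
    (H : HasWeakDeriv I u g) (hg : LocallyIntegrable g volume) :
    ∃ d, ∀ x ∈ J, u x = d + ∫ t in (0 : ℝ)..x, g t := by
  obtain ⟨d, hd⟩ := H.ae_eq_primitive hI hoc hne hg
  refine ⟨d, eqOn_of_ae_eq hI hIJ hJI hu (Continuous.continuousOn ?_) hd⟩
  exact continuous_const.add
    (intervalIntegral.continuous_primitive (intervalIntegrable_of_locallyIntegrable hg) 0)

/-- A continuous function that is differentiable off a countable set is weakly differentiable. -/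
theorem of_hasDerivAt_off_countable (hI : IsOpen I) {s : Set ℝ} (hs : s.Countable)
    (hu : Continuous u) (hd : ∀ x ∉ s, HasDerivAt u (g x) x) (hg : LocallyIntegrable g volume) :
    HasWeakDeriv I u g :=
  of_primitive hI hg (u 0) fun x _ => by
    rw [integral_eq_of_hasDerivAt_off_countable u g hs hu.continuousOn (fun y hy => hd y hy.2)
      (intervalIntegrable_of_locallyIntegrable hg 0 x)]
    ring

theorem of_hasDerivAt (hI : IsOpen I) (hd : ∀ x, HasDerivAt u (g x) x) (hg : Continuous g) :
    HasWeakDeriv I u g :=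
  of_hasDerivAt_off_countable hI countable_empty
    (continuous_iff_continuousAt.mpr fun x => (hd x).continuousAt) (fun x _ => hd x)
    hg.locallyIntegrable

end HasWeakDeriv

/-! ### `H¹` functions on an interval -/

/-- Sobolev embedding with a crude constant. As `|g| ≤ 1 + |g|²`, the oscillation of `u` on a unit
interval is at most `1 + A`; averaging `|u x| ≤ (1 + |u y|²) + (1 + A)` over `y ∈ [x, x + 1]` bounds
`u` by its `L²` norm. -/
theorem exists_bound_of_weakDeriv_Ioi {u g : ℝ → ℂ} (hu : ContinuousOn u (Ici 0))
    (H : HasWeakDeriv (Ioi 0) u g) (hu2 : MemLp u 2 (volume.restrict (Ioi 0)))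
    (hg2 : MemLp g 2 (volume.restrict (Ioi 0))) : ∃ C : ℝ, ∀ x ∈ Ici (0 : ℝ), ‖u x‖ ≤ C := by
  set g' : ℝ → ℂ := (Ioi 0).indicator g with hg'
  have hg'2 : MemLp g' 2 volume := (memLp_indicator_iff_restrict measurableSet_Ioi).mpr hg2
  have hg'l : LocallyIntegrable g' volume := hg'2.locallyIntegrable (by norm_num)
  have H' : HasWeakDeriv (Ioi 0) u g' := H.congr_ae isOpen_Ioi (.of_forall fun _ => rfl)
    ((ae_restrict_mem measurableSet_Ioi).mono fun x hx => by rw [hg', indicator_of_mem hx])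
  obtain ⟨d, hd⟩ := HasWeakDeriv.eqOn_primitive isOpen_Ioi ordConnected_Ioi nonempty_Ioi
    Ioi_subset_Ici_self (closure_Ioi (0 : ℝ)).ge hu H' hg'l
  have hgi : Integrable fun x => ‖g' x‖ ^ 2 := hg'2.integrable_norm_pow (by norm_num)
  have hui : IntegrableOn (fun x => ‖u x‖ ^ 2) (Ioi 0) := hu2.integrable_norm_pow (by norm_num)
  set A := ∫ x, ‖g' x‖ ^ 2
  set B := ∫ x in Ioi 0, ‖u x‖ ^ 2
  have step : ∀ x ∈ Ici (0 : ℝ), ∀ y ∈ Icc x (x + 1), ‖u x‖ ≤ (1 + ‖u y‖ ^ 2) + (1 + A) := by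
    intro x hx y hy
    have hy0 : y ∈ Ici (0 : ℝ) := le_trans hx hy.1
    have h1 : u y - u x = ∫ t in x..y, g' t := by
      rw [hd x hx, hd y hy0, add_sub_add_left_eq_sub]
      exact intervalIntegral.integral_interval_sub_left
        (intervalIntegrable_of_locallyIntegrable hg'l _ _)
        (intervalIntegrable_of_locallyIntegrable hg'l _ _)
    have h2 : ‖u y - u x‖ ≤ 1 + A := by
      rw [h1]
      calc ‖∫ t in x..y, g' t‖ ≤ ∫ t in x..y, ‖g' t‖ :=
            intervalIntegral.norm_integral_le_integral_norm hy.1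
        _ ≤ ∫ t in x..y, (1 + ‖g' t‖ ^ 2) := by
            refine intervalIntegral.integral_mono_on hy.1
              (intervalIntegrable_of_locallyIntegrable hg'l _ _).norm ?_ ?_
            · exact (intervalIntegrable_const).add hgi.intervalIntegrable
            · intro t _; nlinarith [sq_nonneg (‖g' t‖ - 1), norm_nonneg (g' t)]
        _ = (y - x) + ∫ t in x..y, ‖g' t‖ ^ 2 := by
            rw [intervalIntegral.integral_add intervalIntegrable_const hgi.intervalIntegrable]
            simp
        _ ≤ 1 + A := by
            refine add_le_add (by linarith [hy.2]) ?_
            rw [intervalIntegral.integral_of_le hy.1]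
            exact setIntegral_le_integral hgi (.of_forall fun t => by positivity)
    have h3 := norm_le_norm_add_norm_sub' (u x) (u y)
    rw [norm_sub_rev] at h3
    nlinarith [sq_nonneg (‖u y‖ - 1), norm_nonneg (u y)]
  refine ⟨(1 + B) + (1 + A), fun x hx => ?_⟩
  have hsub : Ioc x (x + 1) ⊆ Ioi 0 := fun y hy => lt_of_le_of_lt hx hy.1
  have hint : IntegrableOn (fun y => (1 + ‖u y‖ ^ 2) + (1 + A)) (Ioc x (x + 1)) :=
    ((integrable_const _).add (hui.mono_set hsub)).add (integrable_const _)
  calc ‖u x‖ = ∫ _ in Ioc x (x + 1), ‖u x‖ := by simp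
    _ ≤ ∫ y in Ioc x (x + 1), ((1 + ‖u y‖ ^ 2) + (1 + A)) :=
        setIntegral_mono_on (integrable_const _) hint measurableSet_Ioc
          fun y hy => step x hx y ⟨hy.1.le, hy.2⟩
    _ = (1 + ∫ y in Ioc x (x + 1), ‖u y‖ ^ 2) + (1 + A) := by
        have hi : IntegrableOn (fun y => 1 + ‖u y‖ ^ 2) (Ioc x (x + 1)) :=
          (integrable_const _).add (hui.mono_set hsub)
        rw [integral_add hi (integrable_const _),
          integral_add (integrable_const _) (hui.mono_set hsub)]
        simp
    _ ≤ _ := by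
        gcongr
        exact setIntegral_mono_set hui (.of_forall fun t => by positivity) hsub.eventuallyLE

/-! ### Edges of a metric graph and `H¹` functions with an explicit derivative -/

namespace MetricGraph

variable {V E H : Type*} (Γ : MetricGraph V E H)

theorem isOpen_openEdge (e : E ⊕ H) : IsOpen (Γ.openEdge e) := by
  cases e
  exacts [isOpen_Ioo, isOpen_Ioi]

theorem ordConnected_openEdge (e : E ⊕ H) : (Γ.openEdge e).OrdConnected := by
  cases e
  exacts [ordConnected_Ioo, ordConnected_Ioi]

theorem ordConnected_closedEdge (e : E ⊕ H) : (Γ.closedEdge e).OrdConnected := by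
  cases e
  exacts [ordConnected_Icc, ordConnected_Ici]

theorem nonempty_openEdge (e : E ⊕ H) : (Γ.openEdge e).Nonempty := by
  cases e with
  | inl e => exact nonempty_Ioo.mpr (Γ.len_pos e)
  | inr h => exact nonempty_Ioi

theorem openEdge_subset_closedEdge (e : E ⊕ H) : Γ.openEdge e ⊆ Γ.closedEdge e := by
  cases e
  exacts [Ioo_subset_Icc_self, Ioi_subset_Ici_self]

theorem closure_openEdge (e : E ⊕ H) : closure (Γ.openEdge e) = Γ.closedEdge e := by
  cases e with
  | inl e => exact closure_Ioo (Γ.len_pos e).ne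
  | inr h => exact closure_Ioi 0

theorem zero_mem_closedEdge (e : E ⊕ H) : (0 : ℝ) ∈ Γ.closedEdge e := by
  cases e with
  | inl e => exact ⟨le_rfl, (Γ.len_pos e).le⟩
  | inr h => exact self_mem_Ici

theorem measurableSet_openEdge (e : E ⊕ H) : MeasurableSet (Γ.openEdge e) :=
  (Γ.isOpen_openEdge e).measurableSet

theorem ae_mem_closedEdge (e : E ⊕ H) : ∀ᵐ x ∂volume.restrict (Γ.openEdge e), x ∈ Γ.closedEdge e :=
  (ae_restrict_mem (Γ.measurableSet_openEdge e)).mono fun _ hx => Γ.openEdge_subset_closedEdge e hx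

/-- `g` is the edgewise weak derivative of the `H¹_Γ` function `U`. -/
structure HasH1Deriv (U g : E ⊕ H → ℝ → ℂ) : Prop where
  hasWeakDeriv : ∀ e, HasWeakDeriv (Γ.openEdge e) (U e) (g e)
  memLp : ∀ e, MemLp (U e) 2 (volume.restrict (Γ.openEdge e))
  memLp_deriv : ∀ e, MemLp (g e) 2 (volume.restrict (Γ.openEdge e))
  isContinuous : Γ.IsContinuous U

/-- `weakDeriv` is a mere choice up to null sets, so an explicit representative of the derivative is
carried along instead. -/
theorem memH1_iff {U : E ⊕ H → ℝ → ℂ} : Γ.MemH1 U ↔ ∃ g, Γ.HasH1Deriv U g := by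
  constructor
  · rintro ⟨h1, h2⟩
    choose h3 g hg hg2 using h1
    exact ⟨g, hg, h3, hg2, h2⟩
  · rintro ⟨g, h⟩
    exact ⟨fun e => ⟨h.memLp e, g e, h.hasWeakDeriv e, h.memLp_deriv e⟩, h.isContinuous⟩

variable {Γ}

theorem IsContinuous.add {U W : E ⊕ H → ℝ → ℂ} (hU : Γ.IsContinuous U) (hW : Γ.IsContinuous W) :
    Γ.IsContinuous fun e x => U e x + W e x := by
  obtain ⟨h1, p, h2, h3⟩ := hU
  obtain ⟨k1, r, k2, k3⟩ := hW
  exact ⟨fun e => (h1 e).add (k1 e), fun v => p v + r v,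
    fun e => ⟨by simp only [(h2 e).1, (k2 e).1], by simp only [(h2 e).2, (k2 e).2]⟩,
    fun h => by simp only [h3, k3]⟩

theorem IsContinuous.const_mul {U : E ⊕ H → ℝ → ℂ} (c : ℂ) (hU : Γ.IsContinuous U) :
    Γ.IsContinuous fun e x => c * U e x := by
  obtain ⟨h1, p, h2, h3⟩ := hU
  exact ⟨fun e => continuousOn_const.mul (h1 e), fun v => c * p v,
    fun e => ⟨by simp only [(h2 e).1], by simp only [(h2 e).2]⟩, fun h => by simp only [h3]⟩

namespace HasH1Deriv

variable {U W g k : E ⊕ H → ℝ → ℂ}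

theorem add (hU : Γ.HasH1Deriv U g) (hW : Γ.HasH1Deriv W k) :
    Γ.HasH1Deriv (fun e x => U e x + W e x) (fun e x => g e x + k e x) :=
  ⟨fun e => (hU.hasWeakDeriv e).add (hW.hasWeakDeriv e), fun e => (hU.memLp e).add (hW.memLp e),
    fun e => (hU.memLp_deriv e).add (hW.memLp_deriv e), hU.isContinuous.add hW.isContinuous⟩

theorem const_mul (c : ℂ) (hU : Γ.HasH1Deriv U g) :
    Γ.HasH1Deriv (fun e x => c * U e x) (fun e x => c * g e x) :=
  ⟨fun e => (hU.hasWeakDeriv e).const_mul c, fun e => (hU.memLp e).const_mul c,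
    fun e => (hU.memLp_deriv e).const_mul c, hU.isContinuous.const_mul c⟩

theorem memH1 (hU : Γ.HasH1Deriv U g) : Γ.MemH1 U := Γ.memH1_iff.mpr ⟨g, hU⟩

theorem exists_bound (hU : Γ.HasH1Deriv U g) (e : E ⊕ H) :
    ∃ C : ℝ, ∀ x ∈ Γ.closedEdge e, ‖U e x‖ ≤ C := by
  have hc := hU.isContinuous.1 e
  have hw := hU.hasWeakDeriv e
  have h1 := hU.memLp e
  have h2 := hU.memLp_deriv e
  cases e with
  | inl e => exact isCompact_Icc.exists_bound_of_continuousOn hc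
  | inr h => exact exists_bound_of_weakDeriv_Ioi hc hw h1 h2

theorem integrable_sq (hU : Γ.HasH1Deriv U g) (e : E ⊕ H) :
    Integrable (fun x => ‖U e x‖ ^ 2) (volume.restrict (Γ.openEdge e)) :=
  (hU.memLp e).integrable_norm_pow (by norm_num)

theorem integrable_deriv_sq (hU : Γ.HasH1Deriv U g) (e : E ⊕ H) :
    Integrable (fun x => ‖g e x‖ ^ 2) (volume.restrict (Γ.openEdge e)) :=
  (hU.memLp_deriv e).integrable_norm_pow (by norm_num)

theorem integrable_pow_four (hU : Γ.HasH1Deriv U g) (e : E ⊕ H) :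
    Integrable (fun x => ‖U e x‖ ^ 4) (volume.restrict (Γ.openEdge e)) := by
  obtain ⟨C, hC⟩ := hU.exists_bound e
  refine ((hU.integrable_sq e).const_mul (C ^ 2)).mono' ?_ ?_
  · exact (hU.memLp e).aestronglyMeasurable.norm.pow 4
  · filter_upwards [Γ.ae_mem_closedEdge e] with x hx
    rw [Real.norm_of_nonneg (by positivity)]
    have := pow_le_pow_left₀ (norm_nonneg _) (hC x hx) 2
    nlinarith [sq_nonneg ‖U e x‖]

end HasH1Deriv

variable [Fintype E] [Fintype H]

variable (Γ) in
/-- The kinetic energy, given the edgewise weak derivative. -/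
noncomputable def kinetic (g : E ⊕ H → ℝ → ℂ) : ℝ := ∑ e, ∫ x in Γ.openEdge e, ‖g e x‖ ^ 2

variable (Γ) in
/-- The quartic part of the energy. -/
noncomputable def quartic (U : E ⊕ H → ℝ → ℂ) : ℝ := ∑ e, ∫ x in Γ.openEdge e, ‖U e x‖ ^ 4

theorem HasH1Deriv.energy_eq {U g : E ⊕ H → ℝ → ℂ} (hU : Γ.HasH1Deriv U g) :
    Γ.energy U = Γ.kinetic g - Γ.quartic U := by
  rw [energy, kinetic, quartic, ← Finset.sum_sub_distrib]
  refine Finset.sum_congr rfl fun e _ => ?_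
  rw [← integral_sub (hU.integrable_deriv_sq e) (hU.integrable_pow_four e)]
  refine integral_congr_ae ?_
  filter_upwards [(hU.hasWeakDeriv e).weakDeriv_ae_eq (Γ.isOpen_openEdge e)] with x hx
  rw [hx]

theorem mass_const_mul (c : ℂ) (U : E ⊕ H → ℝ → ℂ) :
    Γ.mass (fun e x => c * U e x) = ‖c‖ ^ 2 * Γ.mass U := by
  simp only [mass, norm_mul, mul_pow, integral_const_mul, Finset.mul_sum]

theorem kinetic_const_mul (c : ℂ) (U : E ⊕ H → ℝ → ℂ) :
    Γ.kinetic (fun e x => c * U e x) = ‖c‖ ^ 2 * Γ.kinetic U := by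
  simp only [kinetic, norm_mul, mul_pow, integral_const_mul, Finset.mul_sum]

theorem quartic_const_mul (c : ℂ) (U : E ⊕ H → ℝ → ℂ) :
    Γ.quartic (fun e x => c * U e x) = ‖c‖ ^ 4 * Γ.quartic U := by
  simp only [quartic, norm_mul, mul_pow, integral_const_mul, Finset.mul_sum]

end MetricGraph

/-! ### The Euler–Lagrange equation -/

/-- Dominates the mixed terms in the expansion of `|u + tv|⁴`, making each of them integrable. -/
theorem pow_four_le_add (a b : ℝ) :
    a ^ 3 * b ≤ a ^ 4 + b ^ 4 ∧ a ^ 2 * b ^ 2 ≤ a ^ 4 + b ^ 4 ∧ a * b ^ 3 ≤ a ^ 4 + b ^ 4 := by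
  have h : a ^ 2 * b ^ 2 ≤ (a ^ 4 + b ^ 4) / 2 := by nlinarith [sq_nonneg (a ^ 2 - b ^ 2)]
  refine ⟨?_, ?_, ?_⟩
  · nlinarith [sq_nonneg (a * (a - b)), sq_nonneg (a ^ 2), sq_nonneg (b ^ 2)]
  · nlinarith [sq_nonneg (a ^ 2), sq_nonneg (b ^ 2)]
  · nlinarith [sq_nonneg (b * (a - b)), sq_nonneg (a ^ 2), sq_nonneg (b ^ 2)]

theorem norm_add_smul_sq (z w : ℂ) (t : ℝ) :
    ‖z + t * w‖ ^ 2 = ‖z‖ ^ 2 + t * (2 * inner ℝ z w) + t ^ 2 * ‖w‖ ^ 2 := by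
  rw [← Complex.real_smul, norm_add_sq_real, inner_smul_right, norm_smul, mul_pow, Real.norm_eq_abs,
    sq_abs]
  ring

section Expansion

variable {α : Type*} [MeasurableSpace α] {μ : Measure α} {u v : α → ℂ}

theorem integrable_inner_of_sq (hu : MemLp u 2 μ) (hv : MemLp v 2 μ) :
    Integrable (fun x => inner ℝ (u x) (v x)) μ := by
  have hu2 : Integrable (fun x => ‖u x‖ ^ 2) μ := hu.integrable_norm_pow (by norm_num)
  have hv2 : Integrable (fun x => ‖v x‖ ^ 2) μ := hv.integrable_norm_pow (by norm_num)
  refine (hu2.add hv2).mono' (hu.1.inner hv.1) (.of_forall fun x => ?_)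
  refine (norm_inner_le_norm (𝕜 := ℝ) _ _).trans ?_
  simp only [Pi.add_apply]
  nlinarith [sq_nonneg (‖u x‖ - ‖v x‖), sq_nonneg ‖u x‖, sq_nonneg ‖v x‖]

theorem integral_norm_add_sq (hu : MemLp u 2 μ) (hv : MemLp v 2 μ) (t : ℝ) :
    ∫ x, ‖u x + t * v x‖ ^ 2 ∂μ =
      (∫ x, ‖u x‖ ^ 2 ∂μ) + t * (2 * ∫ x, inner ℝ (u x) (v x) ∂μ) + t ^ 2 * ∫ x, ‖v x‖ ^ 2 ∂μ := by
  have hu2 : Integrable (fun x => ‖u x‖ ^ 2) μ := hu.integrable_norm_pow (by norm_num)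
  have hv2 : Integrable (fun x => ‖v x‖ ^ 2) μ := hv.integrable_norm_pow (by norm_num)
  have hi := integrable_inner_of_sq hu hv
  simp only [norm_add_smul_sq]
  rw [integral_add (hu2.fun_add ((hi.const_mul 2).const_mul t)) (hv2.const_mul _),
    integral_add hu2 ((hi.const_mul 2).const_mul t)]
  simp only [integral_const_mul]

theorem integrable_sq_mul_inner (hu : AEStronglyMeasurable u μ) (hv : AEStronglyMeasurable v μ)
    (hu4 : Integrable (fun x => ‖u x‖ ^ 4) μ) (hv4 : Integrable (fun x => ‖v x‖ ^ 4) μ) :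
    Integrable (fun x => ‖u x‖ ^ 2 * inner ℝ (u x) (v x)) μ := by
  refine (hu4.add hv4).mono' ((hu.norm.pow 2).mul (hu.inner hv)) (.of_forall fun x => ?_)
  rw [norm_mul, norm_pow, norm_norm]
  calc ‖u x‖ ^ 2 * ‖inner ℝ (u x) (v x)‖ ≤ ‖u x‖ ^ 2 * (‖u x‖ * ‖v x‖) := by
        gcongr; exact norm_inner_le_norm _ _
    _ = ‖u x‖ ^ 3 * ‖v x‖ := by ring
    _ ≤ _ := (pow_four_le_add _ _).1

/-- Only the coefficient of `t` enters the first-order condition, so the higher ones are left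
unspecified. -/
theorem exists_integral_norm_add_pow_four (hu : AEStronglyMeasurable u μ)
    (hv : AEStronglyMeasurable v μ)
    (hu4 : Integrable (fun x => ‖u x‖ ^ 4) μ) (hv4 : Integrable (fun x => ‖v x‖ ^ 4) μ) :
    ∃ a b c : ℝ, ∀ t : ℝ, ∫ x, ‖u x + t * v x‖ ^ 4 ∂μ =
      (∫ x, ‖u x‖ ^ 4 ∂μ) + t * (4 * ∫ x, ‖u x‖ ^ 2 * inner ℝ (u x) (v x) ∂μ)
        + t ^ 2 * a + t ^ 3 * b + t ^ 4 * c := by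
  have h1 := integrable_sq_mul_inner hu hv hu4 hv4
  have h2 : Integrable (fun x => 4 * (inner ℝ (u x) (v x)) ^ 2 + 2 * (‖u x‖ ^ 2 * ‖v x‖ ^ 2)) μ := by
    refine ((hu4.add hv4).const_mul 6).mono' ((((hu.inner hv).pow 2).const_mul 4).add
      (((hu.norm.pow 2).mul (hv.norm.pow 2)).const_mul 2)) (.of_forall fun x => ?_)
    rw [Real.norm_of_nonneg (by positivity)]
    have hle := pow_le_pow_left₀ (norm_nonneg _) (norm_inner_le_norm (𝕜 := ℝ) (u x) (v x)) 2
    rw [Real.norm_eq_abs, sq_abs, mul_pow] at hle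
    have := (pow_four_le_add ‖u x‖ ‖v x‖).2.1
    simp only [Pi.add_apply]
    linarith
  have h3 : Integrable (fun x => 4 * (inner ℝ (u x) (v x) * ‖v x‖ ^ 2)) μ := by
    refine ((hu4.add hv4).mono' ((hu.inner hv).mul (hv.norm.pow 2))
      (.of_forall fun x => ?_)).const_mul 4
    simp only [Pi.mul_apply, Pi.pow_apply]
    rw [norm_mul, norm_pow, norm_norm]
    calc ‖inner ℝ (u x) (v x)‖ * ‖v x‖ ^ 2 ≤ (‖u x‖ * ‖v x‖) * ‖v x‖ ^ 2 := by
          gcongr; exact norm_inner_le_norm _ _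
      _ = ‖u x‖ * ‖v x‖ ^ 3 := by ring
      _ ≤ _ := (pow_four_le_add _ _).2.2
  refine ⟨∫ x, (4 * (inner ℝ (u x) (v x)) ^ 2 + 2 * (‖u x‖ ^ 2 * ‖v x‖ ^ 2)) ∂μ,
    ∫ x, (4 * (inner ℝ (u x) (v x) * ‖v x‖ ^ 2)) ∂μ, ∫ x, ‖v x‖ ^ 4 ∂μ, fun t => ?_⟩
  have hexp : ∀ x, ‖u x + t * v x‖ ^ 4 = ‖u x‖ ^ 4 + t * (4 * (‖u x‖ ^ 2 * inner ℝ (u x) (v x)))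
      + t ^ 2 * (4 * (inner ℝ (u x) (v x)) ^ 2 + 2 * (‖u x‖ ^ 2 * ‖v x‖ ^ 2))
      + t ^ 3 * (4 * (inner ℝ (u x) (v x) * ‖v x‖ ^ 2)) + t ^ 4 * ‖v x‖ ^ 4 := fun x => by
    have : ‖u x + t * v x‖ ^ 4 = (‖u x + t * v x‖ ^ 2) ^ 2 := by ring
    rw [this, norm_add_smul_sq]; ring
  simp only [hexp]
  have i1 := (h1.const_mul 4).const_mul t
  have i2 := h2.const_mul (t ^ 2)
  have i3 := h3.const_mul (t ^ 3)
  have i4 := hv4.const_mul (t ^ 4)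
  rw [integral_add (((hu4.fun_add i1).fun_add i2).fun_add i3) i4,
    integral_add ((hu4.fun_add i1).fun_add i2) i3,
    integral_add (hu4.fun_add i1) i2, integral_add hu4 i1]
  rw [integral_const_mul (t ^ 4), integral_const_mul (t ^ 3), integral_const_mul (t ^ 2),
    integral_const_mul t, integral_const_mul 4 (fun x => ‖u x‖ ^ 2 * inner ℝ (u x) (v x))]

end Expansion

/-- First-order condition for the scale-invariant form of the constrained problem. -/
theorem first_order_condition {q k₀ k₁ k₂ p₀ p₁ a b c m₁ m₂ : ℝ} (hq : 0 < q)
    (h : ∀ t : ℝ, 0 < q + t * (2 * m₁) + t ^ 2 * m₂ →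
      (k₀ - p₀) * (q + t * (2 * m₁) + t ^ 2 * m₂) ^ 2 ≤
        q * (q + t * (2 * m₁) + t ^ 2 * m₂) * (k₀ + t * (2 * k₁) + t ^ 2 * k₂) -
          q ^ 2 * (p₀ + t * (4 * p₁) + t ^ 2 * a + t ^ 3 * b + t ^ 4 * c)) :
    k₁ - 2 * p₁ = (k₀ - 2 * p₀) / q * m₁ := by
  -- With `M(t)`, `K(t)`, `P(t)` the three polynomials, `h` is `E ≤ (q/M) K - (q/M)² P` multiplied
  -- by `M²`. The difference `F` of the two sides vanishes at `0` and is non-negative nearby, so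
  -- `F'(0) = 0`; this derivative is `2q` times the claim cleared of its denominator.
  set F : ℝ → ℝ := fun t =>
    q * (q + t * (2 * m₁) + t ^ 2 * m₂) * (k₀ + t * (2 * k₁) + t ^ 2 * k₂) -
      q ^ 2 * (p₀ + t * (4 * p₁) + t ^ 2 * a + t ^ 3 * b + t ^ 4 * c) -
      (k₀ - p₀) * (q + t * (2 * m₁) + t ^ 2 * m₂) ^ 2 with hF
  have hpos : ∀ᶠ t in nhds (0 : ℝ), 0 < q + t * (2 * m₁) + t ^ 2 * m₂ := by
    have : ContinuousAt (fun t : ℝ => q + t * (2 * m₁) + t ^ 2 * m₂) 0 := by fun_prop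
    exact continuousAt_const.eventually_lt this (by simpa using hq)
  have hmin : IsLocalMin F 0 := by
    filter_upwards [hpos] with t ht
    have h1 := h t ht
    have h0 : F 0 = 0 := by simp only [hF]; ring
    rw [h0]; simp only [hF]; linarith
  have hM : HasDerivAt (fun t : ℝ => q + t * (2 * m₁) + t ^ 2 * m₂) (2 * m₁) 0 := by
    have := ((hasDerivAt_id (0 : ℝ)).mul_const (2 * m₁)).const_add q |>.fun_add
      (((hasDerivAt_id (0 : ℝ)).pow 2).mul_const m₂)
    simpa using this
  have hK : HasDerivAt (fun t : ℝ => k₀ + t * (2 * k₁) + t ^ 2 * k₂) (2 * k₁) 0 := by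
    have := ((hasDerivAt_id (0 : ℝ)).mul_const (2 * k₁)).const_add k₀ |>.fun_add
      (((hasDerivAt_id (0 : ℝ)).pow 2).mul_const k₂)
    simpa using this
  have hP : HasDerivAt (fun t : ℝ => p₀ + t * (4 * p₁) + t ^ 2 * a + t ^ 3 * b + t ^ 4 * c)
      (4 * p₁) 0 := by
    have := (((((hasDerivAt_id (0 : ℝ)).mul_const (4 * p₁)).const_add p₀).fun_add
      (((hasDerivAt_id (0 : ℝ)).pow 2).mul_const a)).fun_add
      (((hasDerivAt_id (0 : ℝ)).pow 3).mul_const b)).fun_add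
      (((hasDerivAt_id (0 : ℝ)).pow 4).mul_const c)
    simpa using this
  have hder := (((hM.const_mul q).mul hK).sub (hP.const_mul (q ^ 2))).sub
    ((hM.pow 2).const_mul (k₀ - p₀))
  have h0 := hmin.hasDerivAt_eq_zero hder
  norm_num at h0
  field_simp
  have : 2 * q * (q * (k₁ - 2 * p₁) - (k₀ - 2 * p₀) * m₁) = 0 := by linear_combination h0
  have := (mul_eq_zero.mp this).resolve_left (by positivity)
  linarith

namespace MetricGraph

variable {V E H : Type*} {Γ : MetricGraph V E H} [Fintype E] [Fintype H]

/-- The Euler–Lagrange equation of the constrained problem. -/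
theorem IsGroundState.euler_lagrange_inner {q : ℝ} (hq : 0 < q) {Φ g W k : E ⊕ H → ℝ → ℂ}
    (hΦ : Γ.IsGroundState q Φ) (hg : Γ.HasH1Deriv Φ g) (hW : Γ.HasH1Deriv W k) :
    (∑ e, ∫ x in Γ.openEdge e, inner ℝ (g e x) (k e x)) -
      2 * (∑ e, ∫ x in Γ.openEdge e, ‖Φ e x‖ ^ 2 * inner ℝ (Φ e x) (W e x)) =
    (Γ.kinetic g - 2 * Γ.quartic Φ) / q * ∑ e, ∫ x in Γ.openEdge e, inner ℝ (Φ e x) (W e x) := by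
  choose a b c habc using fun e => exists_integral_norm_add_pow_four (hg.memLp e).1 (hW.memLp e).1
    (hg.integrable_pow_four e) (hW.integrable_pow_four e)
  have hM (t : ℝ) : Γ.mass (fun e x => Φ e x + t * W e x) =
      q + t * (2 * ∑ e, ∫ x in Γ.openEdge e, inner ℝ (Φ e x) (W e x)) + t ^ 2 * Γ.mass W := by
    rw [← hΦ.2.1]
    simp only [mass, integral_norm_add_sq (hg.memLp _) (hW.memLp _), Finset.sum_add_distrib,
      Finset.mul_sum]
  have hK (t : ℝ) : Γ.kinetic (fun e x => g e x + t * k e x) =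
      Γ.kinetic g + t * (2 * ∑ e, ∫ x in Γ.openEdge e, inner ℝ (g e x) (k e x))
        + t ^ 2 * Γ.kinetic k := by
    simp only [kinetic, integral_norm_add_sq (hg.memLp_deriv _) (hW.memLp_deriv _),
      Finset.sum_add_distrib, Finset.mul_sum]
  have hP (t : ℝ) : Γ.quartic (fun e x => Φ e x + t * W e x) =
      Γ.quartic Φ + t * (4 * ∑ e, ∫ x in Γ.openEdge e, ‖Φ e x‖ ^ 2 * inner ℝ (Φ e x) (W e x))
        + t ^ 2 * (∑ e, a e) + t ^ 3 * (∑ e, b e) + t ^ 4 * (∑ e, c e) := by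
    simp only [quartic, habc, Finset.sum_add_distrib, Finset.mul_sum]
  refine first_order_condition hq (k₂ := Γ.kinetic k) (m₂ := Γ.mass W) (a := ∑ e, a e)
    (b := ∑ e, b e) (c := ∑ e, c e) fun t ht => ?_
  rw [← hM] at ht ⊢
  rw [← hK, ← hP]
  set M := Γ.mass (fun e x => Φ e x + t * W e x) with hMdef
  -- Scaling `Φ + tW` by `√(q/M)` restores the mass `q`, so the constraint puts no restriction on
  -- `W`.
  have hs : ‖((√(q / M) : ℝ) : ℂ)‖ ^ 2 = q / M := by
    rw [Complex.norm_real, Real.norm_eq_abs, sq_abs, Real.sq_sqrt (by positivity)]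
  have hV := (hg.add (hW.const_mul t)).const_mul ((√(q / M) : ℝ) : ℂ)
  have hle := hΦ.2.2 _ hV.memH1 (by
    rw [mass_const_mul, hs, ← hMdef]; field_simp)
  rw [hg.energy_eq, hV.energy_eq, kinetic_const_mul, quartic_const_mul,
    show ‖((√(q / M) : ℝ) : ℂ)‖ ^ 4 = (‖((√(q / M) : ℝ) : ℂ)‖ ^ 2) ^ 2 by ring, hs] at hle
  have := mul_le_mul_of_nonneg_right hle (sq_nonneg M)
  refine this.trans (le_of_eq ?_)
  field_simp

end MetricGraph

/-! ### Regularity of ground states -/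

namespace MetricGraph

variable {V E H : Type*} (Γ : MetricGraph V E H)

/-- The nearest-point retraction of the line onto a closed edge. -/
noncomputable def retract : E ⊕ H → ℝ → ℝ
  | .inl e, x => max 0 (min x (Γ.len e))
  | .inr _, x => max 0 x

theorem continuous_retract (e : E ⊕ H) : Continuous (Γ.retract e) := by
  cases e with
  | inl e => exact continuous_const.max (continuous_id.min continuous_const)
  | inr h => exact continuous_const.max continuous_id

theorem retract_mem (e : E ⊕ H) (x : ℝ) : Γ.retract e x ∈ Γ.closedEdge e := by
  cases e with
  | inl e => exact ⟨le_max_left _ _, max_le (Γ.len_pos e).le (min_le_right _ _)⟩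
  | inr h => exact le_max_left (0 : ℝ) x

theorem retract_of_mem {e : E ⊕ H} {x : ℝ} (hx : x ∈ Γ.closedEdge e) : Γ.retract e x = x := by
  cases e with
  | inl e => simp [retract, min_eq_left hx.2, max_eq_right hx.1]
  | inr h => exact max_eq_right hx

variable {Γ} {Φ g k : E ⊕ H → ℝ → ℂ}

theorem HasH1Deriv.congr_deriv (hg : Γ.HasH1Deriv Φ g)
    (h : ∀ e, ∀ᵐ x ∂volume.restrict (Γ.openEdge e), g e x = k e x) : Γ.HasH1Deriv Φ k :=
  ⟨fun e => (hg.hasWeakDeriv e).congr_ae (Γ.isOpen_openEdge e) (.of_forall fun _ => rfl) (h e),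
    hg.memLp, fun e => (hg.memLp_deriv e).ae_eq (h e), hg.isContinuous⟩

theorem isContinuous_single [DecidableEq (E ⊕ H)] {e : E ⊕ H} {w : ℝ → ℂ} (hw : Continuous w)
    (h0 : ∀ x ∉ Γ.openEdge e, w x = 0) : Γ.IsContinuous (Pi.single e w) := by
  refine ⟨fun e' => ?_, 0, fun e' => ⟨?_, ?_⟩, fun h' => ?_⟩
  · by_cases h : e' = e
    · subst h; simpa using hw.continuousOn
    · rw [Pi.single_eq_of_ne h]; exact continuousOn_const
  all_goals
    simp only [Pi.zero_apply]
  · by_cases h : Sum.inl e' = e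
    · subst h; simp only [Pi.single_eq_same]; exact h0 _ fun h => lt_irrefl _ h.1
    · rw [Pi.single_eq_of_ne h]; rfl
  · by_cases h : Sum.inl e' = e
    · subst h; simp only [Pi.single_eq_same]; exact h0 _ fun h => lt_irrefl _ h.2
    · rw [Pi.single_eq_of_ne h]; rfl
  · by_cases h : Sum.inr h' = e
    · subst h; simp only [Pi.single_eq_same]; exact h0 _ fun h => lt_irrefl (0 : ℝ) h
    · rw [Pi.single_eq_of_ne h]; rfl

/-- These variations inside a single edge yield the differential equation there. -/
theorem hasH1Deriv_single [DecidableEq (E ⊕ H)] {e : E ⊕ H} {η : ℝ → ℝ} (hη : ContDiff ℝ ∞ η)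
    (hc : HasCompactSupport η) (hs : tsupport η ⊆ Γ.openEdge e) (c : ℂ) :
    Γ.HasH1Deriv (Pi.single e fun x => η x • c) (Pi.single e fun x => deriv η x • c) := by
  have hη' : Continuous (deriv η) := hη.continuous_deriv (by exact_mod_cast le_top)
  have hcont : Continuous fun x => η x • c := hη.continuous.smul continuous_const
  have hcont' : Continuous fun x => deriv η x • c := hη'.smul continuous_const
  refine ⟨fun e' => ?_, fun e' => ?_, fun e' => ?_, isContinuous_single hcont fun x hx => ?_⟩
  · by_cases h : e' = e
    · subst h
      simp only [Pi.single_eq_same]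
      exact HasWeakDeriv.of_hasDerivAt (Γ.isOpen_openEdge _)
        (fun x => (hη.differentiable (by simp)).differentiableAt.hasDerivAt.smul_const c) hcont'
    · simp only [Pi.single_eq_of_ne h]
      exact HasWeakDeriv.of_hasDerivAt (Γ.isOpen_openEdge _) (fun x => hasDerivAt_const x 0)
        continuous_const
  · by_cases h : e' = e
    · subst h
      simp only [Pi.single_eq_same]
      exact (hcont.memLp_of_hasCompactSupport hc.smul_right).restrict _
    · simp only [Pi.single_eq_of_ne h]; exact MemLp.zero
  · by_cases h : e' = e
    · subst h
      simp only [Pi.single_eq_same]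
      exact (hcont'.memLp_of_hasCompactSupport hc.deriv.smul_right).restrict _
    · simp only [Pi.single_eq_of_ne h]; exact MemLp.zero
  · rw [image_eq_zero_of_notMem_tsupport fun h => hx (hs h), zero_smul]

/-- A function on the graph with prescribed values at the vertices: affine on the edges of finite
length, a multiple of `b` on the half-lines. -/
noncomputable def vertexExtension (Γ : MetricGraph V E H) (b : ℝ → ℝ) (p : V → ℂ) : E ⊕ H → ℝ → ℂ
  | .inl e, x => p (Γ.src e) + (x / Γ.len e) • (p (Γ.tgt e) - p (Γ.src e))
  | .inr h, x => b x • p (Γ.root h)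

/-- The edgewise derivative of `vertexExtension`. -/
noncomputable def vertexExtensionDeriv (Γ : MetricGraph V E H) (b : ℝ → ℝ) (p : V → ℂ) :
    E ⊕ H → ℝ → ℂ
  | .inl e, _ => (1 / Γ.len e) • (p (Γ.tgt e) - p (Γ.src e))
  | .inr h, x => deriv b x • p (Γ.root h)

theorem memLp_two_Ioo_of_continuous {u : ℝ → ℂ} (hu : Continuous u) (a b : ℝ) :
    MemLp u 2 (volume.restrict (Ioo a b)) := by
  obtain ⟨C, hC⟩ := (isCompact_Icc (a := a) (b := b)).exists_bound_of_continuousOn hu.continuousOn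
  exact MemLp.of_bound hu.aestronglyMeasurable C
    ((ae_restrict_mem measurableSet_Ioo).mono fun x hx => hC x (Ioo_subset_Icc_self hx))

theorem hasDerivAt_vertexExtension {b : ℝ → ℝ} (hb : ContDiff ℝ ∞ b) (p : V → ℂ) (e : E ⊕ H)
    (x : ℝ) : HasDerivAt (Γ.vertexExtension b p e) (Γ.vertexExtensionDeriv b p e x) x := by
  cases e with
  | inl e =>
    exact (((hasDerivAt_id x).div_const (Γ.len e)).smul_const (p (Γ.tgt e) - p (Γ.src e))).const_add
      (p (Γ.src e))
  | inr h =>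
    exact (hb.differentiable (by simp)).differentiableAt.hasDerivAt.smul_const _

/-- These variations yield the Kirchhoff conditions; the cut-off `b` keeps them square-integrable on
the half-lines. -/
theorem hasH1Deriv_vertexExtension {b : ℝ → ℝ} (hb : ContDiff ℝ ∞ b) (hc : HasCompactSupport b)
    (hb0 : b 0 = 1) (p : V → ℂ) :
    Γ.HasH1Deriv (Γ.vertexExtension b p) (Γ.vertexExtensionDeriv b p) := by
  have hb' : Continuous (deriv b) := hb.continuous_deriv (by exact_mod_cast le_top)
  have hcont' (e : E ⊕ H) : Continuous (Γ.vertexExtensionDeriv b p e) := by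
    cases e with
    | inl e => exact continuous_const
    | inr h => exact hb'.smul continuous_const
  have hcont (e : E ⊕ H) : Continuous (Γ.vertexExtension b p e) :=
    continuous_iff_continuousAt.mpr fun x => (hasDerivAt_vertexExtension hb p e x).continuousAt
  refine ⟨fun e => HasWeakDeriv.of_hasDerivAt (Γ.isOpen_openEdge e)
    (hasDerivAt_vertexExtension hb p e) (hcont' e), fun e => ?_, fun e => ?_,
    fun e => (hcont e).continuousOn, p, fun e => ⟨?_, ?_⟩, fun h => ?_⟩
  · cases e with
    | inl e => exact memLp_two_Ioo_of_continuous (hcont _) _ _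
    | inr h => exact ((hcont (.inr h)).memLp_of_hasCompactSupport hc.smul_right).restrict _
  · cases e with
    | inl e => exact memLp_two_Ioo_of_continuous (hcont' _) _ _
    | inr h => exact ((hcont' (.inr h)).memLp_of_hasCompactSupport hc.deriv.smul_right).restrict _
  · simp [vertexExtension]
  · simp [vertexExtension, (Γ.len_pos e).ne']
  · simp [vertexExtension, hb0]

variable (Γ) [Fintype E] [Fintype H]

/-- The Lagrange multiplier of a ground state of mass `q`. -/
noncomputable def multiplier (q : ℝ) (Φ : E ⊕ H → ℝ → ℂ) : ℝ := (Γ.energy Φ - Γ.quartic Φ) / q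

open Classical in
/-- `Ψ` is an edgewise extension of `Φ` to the line, with continuous derivative `G`, which solves
the stationary equation up to the vertices and satisfies the Kirchhoff conditions. -/
structure IsClassicalSolution (Λ : ℝ) (Φ Ψ G : E ⊕ H → ℝ → ℂ) : Prop where
  eqOn : ∀ e, EqOn (Φ e) (Ψ e) (Γ.closedEdge e)
  hasDerivAt : ∀ e x, HasDerivAt (Ψ e) (G e x) x
  continuous_deriv : ∀ e, Continuous (G e)
  hasDerivAt_deriv : ∀ e, ∀ x ∈ Γ.closedEdge e,
    HasDerivAt (G e) (-((2 * ‖Ψ e x‖ ^ 2 + Λ : ℝ) • Ψ e x)) x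
  kirchhoff : ∀ v, (∑ e : E, if Γ.src e = v then G (.inl e) 0 else 0) +
    (∑ e : E, if Γ.tgt e = v then -G (.inl e) (Γ.len e) else 0) +
    (∑ h : H, if Γ.root h = v then G (.inr h) 0 else 0) = 0

variable {Γ} {q : ℝ} {W Ψ G : E ⊕ H → ℝ → ℂ}

/-- One integral per edge is the form needed for integration by parts: the vector paired with `W`
will turn out to be minus the derivative of `g`. -/
theorem IsGroundState.euler_lagrange (hq : 0 < q) (hΦ : Γ.IsGroundState q Φ)
    (hg : Γ.HasH1Deriv Φ g) (hW : Γ.HasH1Deriv W k) :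
    ∑ e, ∫ x in Γ.openEdge e, (inner ℝ (g e x) (k e x) -
      inner ℝ ((2 * ‖Φ e x‖ ^ 2 + Γ.multiplier q Φ : ℝ) • Φ e x) (W e x)) = 0 := by
  have h := hΦ.euler_lagrange_inner hq hg hW
  have hm : (Γ.kinetic g - 2 * Γ.quartic Φ) / q = Γ.multiplier q Φ := by
    rw [multiplier, hg.energy_eq]; ring
  rw [hm, Finset.mul_sum, Finset.mul_sum, ← Finset.sum_sub_distrib, ← sub_eq_zero,
    ← Finset.sum_sub_distrib] at h
  rw [← h]
  refine Finset.sum_congr rfl fun e _ => ?_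
  have i1 := integrable_inner_of_sq (hg.memLp_deriv e) (hW.memLp_deriv e)
  have i2 := (integrable_sq_mul_inner (hg.memLp e).1 (hW.memLp e).1 (hg.integrable_pow_four e)
    (hW.integrable_pow_four e)).const_mul 2
  have i3 := (integrable_inner_of_sq (hg.memLp e) (hW.memLp e)).const_mul (Γ.multiplier q Φ)
  have i12 : Integrable (fun x => inner ℝ (g e x) (k e x) -
      2 * (‖Φ e x‖ ^ 2 * inner ℝ (Φ e x) (W e x))) (volume.restrict (Γ.openEdge e)) := i1.sub i2
  rw [← integral_const_mul, ← integral_const_mul, ← integral_sub i1 i2,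
    ← integral_sub i12 i3]
  congr 1 with x
  rw [real_inner_smul_left]
  ring

/-- The weak form of the stationary equation on a single edge. -/
theorem IsGroundState.hasWeakDeriv_deriv (hq : 0 < q) (hΦ : Γ.IsGroundState q Φ)
    (hg : Γ.HasH1Deriv Φ g) (e : E ⊕ H) :
    HasWeakDeriv (Γ.openEdge e) (g e)
      (fun x => -((2 * ‖Φ e x‖ ^ 2 + Γ.multiplier q Φ : ℝ) • Φ e x)) := by
  classical
  have hcont : ContinuousOn (fun x => (2 * ‖Φ e x‖ ^ 2 + Γ.multiplier q Φ : ℝ) • Φ e x)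
      (Γ.closedEdge e) := by
    have := hg.isContinuous.1 e
    fun_prop
  have hloc := (hcont.mono (Γ.openEdge_subset_closedEdge e)).locallyIntegrableOn (μ := volume)
    (Γ.measurableSet_openEdge e)
  have hgl := memLp_two_locallyIntegrableOn (hg.memLp_deriv e)
  refine ⟨hgl, hloc.neg, fun η hη hc hs => ?_⟩
  have i1 := (integrable_deriv_smul_of_tsupport_subset hη hc hs hgl).restrict (s := Γ.openEdge e)
  have i2 := (integrable_smul_of_tsupport_subset hη.continuous hc hs hloc).restrict
    (s := Γ.openEdge e)
  simp only [smul_neg, integral_neg, neg_neg]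
  -- The variational identity is only real-valued; testing with `η • c` for every `c : ℂ` recovers
  -- the complex one.
  refine ext_inner_left ℝ fun c => ?_
  rw [← integral_inner i1, ← integral_inner i2, ← sub_eq_zero,
    ← integral_sub (i1.const_inner c) (i2.const_inner c)]
  have h := hΦ.euler_lagrange hq hg (hasH1Deriv_single hη hc hs c)
  rw [Finset.sum_eq_single e] at h
  · rw [← h]
    congr 1 with x
    simp only [Pi.single_eq_same]
    simp only [inner_smul_right, real_inner_comm c]
  · intro e' _ hne
    simp [Pi.single_eq_of_ne hne]
  · simp

/-- A ground state is edgewise `C²` up to the vertices and solves the stationary equation. -/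
theorem IsGroundState.exists_extension (hq : 0 < q) (hΦ : Γ.IsGroundState q Φ) :
    ∃ Ψ G : E ⊕ H → ℝ → ℂ, Γ.HasH1Deriv Φ G ∧ (∀ e, EqOn (Φ e) (Ψ e) (Γ.closedEdge e)) ∧
      (∀ e x, HasDerivAt (Ψ e) (G e x) x) ∧ (∀ e, Continuous (G e)) ∧
      ∀ e, ∀ x ∈ Γ.closedEdge e,
        HasDerivAt (G e) (-((2 * ‖Ψ e x‖ ^ 2 + Γ.multiplier q Φ : ℝ) • Ψ e x)) x := by
  obtain ⟨g, hg⟩ := Γ.memH1_iff.mp hΦ.1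
  have key (e : E ⊕ H) : ∃ Ψ G : ℝ → ℂ, (∀ᵐ x ∂volume.restrict (Γ.openEdge e), g e x = G x) ∧
      EqOn (Φ e) Ψ (Γ.closedEdge e) ∧ (∀ x, HasDerivAt Ψ (G x) x) ∧ Continuous G ∧
      ∀ x ∈ Γ.closedEdge e,
        HasDerivAt G (-((2 * ‖Ψ x‖ ^ 2 + Γ.multiplier q Φ : ℝ) • Ψ x)) x := by
    -- The bootstrap: the right-hand side is continuous on the closed edge, and composing with the
    -- retraction extends it continuously to the line. Its primitive `G` and the primitive `Ψ` of
    -- `G` are thus differentiable everywhere, with two-sided derivatives also at the end-vertices.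
    set f : ℝ → ℂ := fun x => -((2 * ‖Φ e (Γ.retract e x)‖ ^ 2 + Γ.multiplier q Φ : ℝ) •
      Φ e (Γ.retract e x)) with hf
    have hΦr : Continuous fun x => Φ e (Γ.retract e x) :=
      (hg.isContinuous.1 e).comp_continuous (Γ.continuous_retract e) (Γ.retract_mem e)
    have hfc : Continuous f := ((((hΦr.norm.pow 2).const_mul 2).add_const _).smul hΦr).neg
    have hprim {u : ℝ → ℂ} (hu : Continuous u) (d : ℂ) (x : ℝ) :
        HasDerivAt (fun x => d + ∫ t in (0 : ℝ)..x, u t) (u x) x :=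
      (intervalIntegral.integral_hasDerivAt_right (hu.intervalIntegrable _ _)
        (hu.stronglyMeasurableAtFilter _ _) hu.continuousAt).const_add d
    have hw : HasWeakDeriv (Γ.openEdge e) (g e) f :=
      (hΦ.hasWeakDeriv_deriv hq hg e).congr_ae (Γ.isOpen_openEdge e) (.of_forall fun _ => rfl)
        ((Γ.ae_mem_closedEdge e).mono fun x hx => by simp only [hf, Γ.retract_of_mem hx])
    obtain ⟨d, hd⟩ := hw.ae_eq_primitive (Γ.isOpen_openEdge e) (Γ.ordConnected_openEdge e)
      (Γ.nonempty_openEdge e) hfc.locallyIntegrable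
    have hGd := hprim hfc d
    set G : ℝ → ℂ := fun x => d + ∫ t in (0 : ℝ)..x, f t
    have hGc : Continuous G := continuous_iff_continuousAt.mpr fun x => (hGd x).continuousAt
    obtain ⟨d', hd'⟩ := HasWeakDeriv.eqOn_primitive (Γ.isOpen_openEdge e)
      (Γ.ordConnected_openEdge e) (Γ.nonempty_openEdge e) (Γ.openEdge_subset_closedEdge e)
      (Γ.closure_openEdge e).ge (hg.isContinuous.1 e)
      ((hg.hasWeakDeriv e).congr_ae (Γ.isOpen_openEdge e) (.of_forall fun _ => rfl) hd)
      hGc.locallyIntegrable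
    refine ⟨fun x => d' + ∫ t in (0 : ℝ)..x, G t, G, hd, hd', hprim hGc d', hGc, fun x hx => ?_⟩
    have := hGd x
    simp only [hf, Γ.retract_of_mem hx] at this
    rwa [hd' x hx] at this
  choose Ψ G h1 h2 h3 h4 h5 using key
  exact ⟨Ψ, G, hg.congr_deriv h1, h2, h3, h4, h5⟩

/-- The Kirchhoff condition is the natural boundary condition. For a variation `W` equal to `c` at
`v` and to `0` at the other vertices, the equation makes the integrand the exact derivative of `⟨G,
W⟩`. Only boundary values remain, and they add up to minus the pairing of the outgoing sum with `c`.
-/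
theorem IsGroundState.exists_isClassicalSolution (hq : 0 < q) (hΦ : Γ.IsGroundState q Φ) :
    ∃ Ψ G : E ⊕ H → ℝ → ℂ, Γ.HasH1Deriv Φ G ∧
      Γ.IsClassicalSolution (Γ.multiplier q Φ) Φ Ψ G := by
  classical
  obtain ⟨Ψ, G, hG, h1, h2, h3, h4⟩ := hΦ.exists_extension hq
  refine ⟨Ψ, G, hG, h1, h2, h3, h4, fun v => ?_⟩
  let b : ContDiffBump (0 : ℝ) := ⟨1, 2, by norm_num, by norm_num⟩
  have hb : ContDiff ℝ ∞ b := b.contDiff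
  have hb0 : b 0 = 1 := b.one_of_mem_closedBall (by simp [b])
  have hb2 : ∀ x : ℝ, 2 ≤ x → b x = 0 := fun x hx => b.zero_of_le_dist (by
    rw [Real.dist_eq, sub_zero]; exact hx.trans (le_abs_self x))
  refine ext_inner_right ℝ fun c => ?_
  rw [inner_zero_left]
  set p : V → ℂ := Pi.single v c with hp
  have hW := hasH1Deriv_vertexExtension (Γ := Γ) hb b.hasCompactSupport hb0 p
  set W := Γ.vertexExtension b p
  set k := Γ.vertexExtensionDeriv b p
  have hEL := hΦ.euler_lagrange hq hG hW
  have hcongr (e : E ⊕ H) : ∫ x in Γ.openEdge e, (inner ℝ (G e x) (k e x) -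
      inner ℝ ((2 * ‖Φ e x‖ ^ 2 + Γ.multiplier q Φ : ℝ) • Φ e x) (W e x)) =
      ∫ x in Γ.openEdge e, (inner ℝ (G e x) (k e x) +
      inner ℝ (-((2 * ‖Ψ e x‖ ^ 2 + Γ.multiplier q Φ : ℝ) • Ψ e x)) (W e x)) := by
    refine setIntegral_congr_fun (Γ.measurableSet_openEdge e) fun x hx => ?_
    simp only [h1 e (Γ.openEdge_subset_closedEdge e hx), inner_neg_left, sub_eq_add_neg]
  have hder (e : E ⊕ H) (x : ℝ) (hx : x ∈ Γ.closedEdge e) :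
      HasDerivAt (fun x => inner ℝ (G e x) (W e x)) (inner ℝ (G e x) (k e x) +
        inner ℝ (-((2 * ‖Ψ e x‖ ^ 2 + Γ.multiplier q Φ : ℝ) • Ψ e x)) (W e x)) x :=
    (h4 e x hx).inner ℝ (hasDerivAt_vertexExtension hb p e x)
  have hΨc (e : E ⊕ H) : Continuous (Ψ e) :=
    continuous_iff_continuousAt.mpr fun x => (h2 e x).continuousAt
  have hWc (e : E ⊕ H) : Continuous (W e) :=
    continuous_iff_continuousAt.mpr fun x => (hasDerivAt_vertexExtension hb p e x).continuousAt
  have hkc (e : E ⊕ H) : Continuous (k e) := by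
    cases e with
    | inl e => exact continuous_const
    | inr h => exact (hb.continuous_deriv (by exact_mod_cast le_top)).smul continuous_const
  have hFc (e : E ⊕ H) : Continuous fun x => (inner ℝ (G e x) (k e x) +
        inner ℝ (-((2 * ‖Ψ e x‖ ^ 2 + Γ.multiplier q Φ : ℝ) • Ψ e x)) (W e x)) := by
    have := hΨc e; have := hWc e; have := hkc e; have := h3 e
    fun_prop
  have hinl (e : E) : ∫ x in Γ.openEdge (.inl e), (inner ℝ (G (.inl e) x) (k (.inl e) x) +
      inner ℝ (-((2 * ‖Ψ (.inl e) x‖ ^ 2 + Γ.multiplier q Φ : ℝ) • Ψ (.inl e) x)) (W (.inl e) x)) =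
      inner ℝ (G (.inl e) (Γ.len e)) (p (Γ.tgt e)) - inner ℝ (G (.inl e) 0) (p (Γ.src e)) := by
    have h0 : W (.inl e) 0 = p (Γ.src e) := by simp [W, vertexExtension]
    have hl : W (.inl e) (Γ.len e) = p (Γ.tgt e) := by
      simp [W, vertexExtension, (Γ.len_pos e).ne']
    rw [openEdge, ← integral_Ioc_eq_integral_Ioo,
      ← intervalIntegral.integral_of_le (Γ.len_pos e).le,
      intervalIntegral.integral_eq_sub_of_hasDerivAt (fun x hx => hder _ x ?_)
        ((hFc _).intervalIntegrable _ _), h0, hl]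
    rwa [uIcc_of_le (Γ.len_pos e).le] at hx
  have hinr (h : H) : ∫ x in Γ.openEdge (.inr h), (inner ℝ (G (.inr h) x) (k (.inr h) x) +
      inner ℝ (-((2 * ‖Ψ (.inr h) x‖ ^ 2 + Γ.multiplier q Φ : ℝ) • Ψ (.inr h) x)) (W (.inr h) x)) =
      - inner ℝ (G (.inr h) 0) (p (Γ.root h)) := by
    have h0 : W (.inr h) 0 = p (Γ.root h) := by simp [W, vertexExtension, hb0]
    have hW2 : ∀ x, 2 ≤ x → W (.inr h) x = 0 := fun x hx => by simp [W, vertexExtension, hb2 x hx]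
    have hk2 : ∀ x, 2 < x → k (.inr h) x = 0 := fun x hx => by
      have : (b : ℝ → ℝ) =ᶠ[nhds x] fun _ => 0 := by
        filter_upwards [lt_mem_nhds hx] with y hy using hb2 y hy.le
      simp [k, vertexExtensionDeriv, this.deriv_eq]
    -- The variation vanishes beyond the outer radius `2` of the bump, so there is no contribution
    -- from infinity.
    rw [openEdge, setIntegral_eq_of_subset_of_forall_sdiff_eq_zero measurableSet_Ioi
      (show Ioc (0 : ℝ) 2 ⊆ Ioi 0 from Ioc_subset_Ioi_self) fun x hx => ?_,
      ← intervalIntegral.integral_of_le zero_le_two,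
      intervalIntegral.integral_eq_sub_of_hasDerivAt (fun x hx => hder _ x ?_)
        ((hFc _).intervalIntegrable _ _), h0, hW2 2 le_rfl, inner_zero_right, zero_sub]
    · rw [uIcc_of_le zero_le_two] at hx
      exact hx.1
    · have hx2 : 2 < x := by
        by_contra hcon
        exact hx.2 ⟨hx.1, not_lt.mp hcon⟩
      simp [hW2 x hx2.le, hk2 x hx2]
  simp only [hcongr, Fintype.sum_sum_type, hinl, hinr, Finset.sum_sub_distrib] at hEL
  have hval (w : V) : p w = if w = v then c else 0 := by simp [hp, Pi.single_apply]
  simp only [hval] at hEL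
  simp only [inner_add_left, sum_inner]
  have e1 (z : ℂ) (P : Prop) [Decidable P] :
      inner ℝ (if P then z else 0) c = inner ℝ z (if P then c else 0) := by
    split_ifs <;> simp
  simp only [e1, inner_neg_left, Finset.sum_neg_distrib] at hEL ⊢
  linarith

end MetricGraph

/-! ### Membership in `H²_Γ` and the stationary equation -/

namespace MetricGraph

variable {V E H : Type*} {Γ : MetricGraph V E H}

theorem uniqueDiffOn_closedEdge (e : E ⊕ H) : UniqueDiffOn ℝ (Γ.closedEdge e) := by
  cases e with
  | inl e => exact uniqueDiffOn_Icc (Γ.len_pos e)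
  | inr h => exact uniqueDiffOn_Ici 0

theorem len_mem_closedEdge (e : E) : Γ.len e ∈ Γ.closedEdge (.inl e) := ⟨(Γ.len_pos e).le, le_rfl⟩

variable {q Λ : ℝ} {Φ Ψ G : E ⊕ H → ℝ → ℂ}

theorem HasH1Deriv.memLp_nonlinearity (hG : Γ.HasH1Deriv Φ G) (e : E ⊕ H) :
    MemLp (fun x => -((2 * ‖Φ e x‖ ^ 2 + Λ : ℝ) • Φ e x)) 2 (volume.restrict (Γ.openEdge e)) := by
  obtain ⟨C, hC⟩ := hG.exists_bound e
  refine (hG.memLp e).of_le_mul (c := 2 * C ^ 2 + |Λ|) ?_ ?_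
  · have h := (hG.memLp e).aestronglyMeasurable
    exact ((((h.norm.pow 2).const_mul 2).add_const Λ).smul h).neg
  · filter_upwards [Γ.ae_mem_closedEdge e] with x hx
    rw [norm_neg, norm_smul]
    gcongr
    refine (norm_add_le _ _).trans (add_le_add ?_ le_rfl)
    rw [Real.norm_of_nonneg (by positivity)]
    gcongr
    exact hC x hx

variable [Fintype E] [Fintype H]

theorem IsClassicalSolution.derivWithin_eq (hs : Γ.IsClassicalSolution Λ Φ Ψ G) {e : E ⊕ H} {x : ℝ}
    (hx : x ∈ Γ.closedEdge e) : derivWithin (Φ e) (Γ.closedEdge e) x = G e x :=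
  ((hs.hasDerivAt e x).hasDerivWithinAt.congr (hs.eqOn e) (hs.eqOn e hx)).derivWithin
    (uniqueDiffOn_closedEdge e x hx)

theorem IsClassicalSolution.outgoingSum_eq_zero (hs : Γ.IsClassicalSolution Λ Φ Ψ G) (v : V) :
    Γ.outgoingSum Φ v = 0 := by
  refine Eq.trans ?_ (hs.kirchhoff v)
  simp only [outgoingSum, hs.derivWithin_eq (Γ.zero_mem_closedEdge _),
    hs.derivWithin_eq (len_mem_closedEdge _)]

theorem IsGroundState.memH2 (hq : 0 < q) (hΦ : Γ.IsGroundState q Φ) : Γ.MemH2 Φ := by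
  obtain ⟨Ψ, G, hG, hs⟩ := hΦ.exists_isClassicalSolution hq
  exact ⟨fun e => ⟨hG.memLp e, G e, hG.hasWeakDeriv e, hG.memLp_deriv e, _,
    hΦ.hasWeakDeriv_deriv hq hG e, hG.memLp_nonlinearity e⟩, hG.isContinuous,
    hs.outgoingSum_eq_zero⟩

theorem IsGroundState.solvesStationaryNLS (hq : 0 < q) (hΦ : Γ.IsGroundState q Φ) :
    Γ.SolvesStationaryNLS (Γ.multiplier q Φ) Φ := by
  obtain ⟨G, hG⟩ := Γ.memH1_iff.mp hΦ.1
  intro e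
  have hI := Γ.isOpen_openEdge e
  have h := ((hΦ.hasWeakDeriv_deriv hq hG e).congr_ae hI
    (((hG.hasWeakDeriv e).weakDeriv_ae_eq hI).mono fun x hx => hx.symm)
    (.of_forall fun _ => rfl)).weakDeriv_ae_eq hI
  filter_upwards [h] with x hx
  rw [hx, Complex.real_smul]
  push_cast
  ring

end MetricGraph

/-! ### Uniqueness for linear second-order equations -/

/-- Grönwall's inequality for the pair `(u, v)`: in the sup norm its derivative is at most `max 1 M`
times the pair, where `M` bounds `w`. -/
theorem eq_zero_right_of_second_order {u v w : ℝ → ℝ} {a b : ℝ}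
    (hu : ∀ x ∈ Icc a b, HasDerivAt u (v x) x)
    (hv : ∀ x ∈ Icc a b, HasDerivAt v (-(w x * u x)) x) (hw : ContinuousOn w (Icc a b))
    (hu0 : u a = 0) (hv0 : v a = 0) : ∀ x ∈ Icc a b, u x = 0 := by
  obtain ⟨M, hM⟩ := isCompact_Icc.exists_bound_of_continuousOn hw
  have hd : ∀ x ∈ Icc a b, HasDerivAt (fun x => (u x, v x)) (v x, -(w x * u x)) x :=
    fun x hx => (hu x hx).prodMk (hv x hx)
  have := eq_zero_of_abs_deriv_le_mul_abs_self_of_eq_zero_right (K := max 1 M)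
    (fun x hx => (hd x hx).continuousAt.continuousWithinAt)
    (fun x hx => (hd x (Ico_subset_Icc_self hx)).hasDerivWithinAt) (by simp [hu0, hv0])
    fun x hx => by
      have hMx := hM x (Ico_subset_Icc_self hx)
      rw [Prod.norm_mk, Prod.norm_mk, norm_neg, norm_mul]
      refine max_le ?_ ?_
      · calc ‖v x‖ = 1 * ‖v x‖ := (one_mul _).symm
          _ ≤ _ := mul_le_mul (le_max_left _ _) (le_max_right _ _) (norm_nonneg _) (by positivity)
      · exact mul_le_mul (hMx.trans (le_max_right _ _)) (le_max_left _ _) (norm_nonneg _)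
          (by positivity)
  exact fun x hx => congrArg Prod.fst (this x hx)

/-- Points to the left of `x₀` are reached by the change of variable `y ↦ -y`. -/
theorem eq_zero_of_second_order {u v w : ℝ → ℝ} {J : Set ℝ} (hJ : J.OrdConnected)
    (hu : ∀ x ∈ J, HasDerivAt u (v x) x) (hv : ∀ x ∈ J, HasDerivAt v (-(w x * u x)) x)
    (hw : ContinuousOn w J) {x₀ : ℝ} (hx₀ : x₀ ∈ J) (hu0 : u x₀ = 0) (hv0 : v x₀ = 0) :
    ∀ x ∈ J, u x = 0 := by
  intro x hx
  rcases le_total x₀ x with h | h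
  · have hsub : Icc x₀ x ⊆ J := hJ.out hx₀ hx
    exact eq_zero_right_of_second_order (fun y hy => hu y (hsub hy)) (fun y hy => hv y (hsub hy))
      (hw.mono hsub) hu0 hv0 x ⟨h, le_rfl⟩
  · have hsub : ∀ y ∈ Icc (-x₀) (-x), -y ∈ J := fun y hy =>
      hJ.out hx hx₀ ⟨by linarith [hy.2], by linarith [hy.1]⟩
    have := eq_zero_right_of_second_order (u := fun y => u (-y)) (v := fun y => -v (-y))
      (w := fun y => w (-y)) (a := -x₀) (b := -x)
      (fun y hy => by simpa [Function.comp_def] using (hu _ (hsub y hy)).comp y (hasDerivAt_neg y))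
      (fun y hy => by
        simpa [Function.comp_def] using ((hv _ (hsub y hy)).comp y (hasDerivAt_neg y)).fun_neg)
      (hw.comp continuous_neg.continuousOn hsub) (by simpa using hu0) (by simpa using hv0)
      (-x) ⟨by linarith, le_rfl⟩
    simpa using this

theorem HasDerivAt.nonneg_of_nonneg_right {f : ℝ → ℝ} {f' a b : ℝ} (hf : HasDerivAt f f' a)
    (hab : a < b) (h0 : f a = 0) (h : ∀ x ∈ Ioo a b, 0 ≤ f x) : 0 ≤ f' := by
  have := hasDerivWithinAt_iff_tendsto_slope' (s := Ioi a) (lt_irrefl a) |>.mp hf.hasDerivWithinAt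
  refine ge_of_tendsto this ?_
  filter_upwards [Ioo_mem_nhdsGT hab] with x hx
  rw [slope_def_field, h0, sub_zero]
  exact div_nonneg (h x hx) (sub_nonneg.mpr hx.1.le)

theorem HasDerivAt.nonpos_of_nonneg_left {f : ℝ → ℝ} {f' a b : ℝ} (hf : HasDerivAt f f' b)
    (hab : a < b) (h0 : f b = 0) (h : ∀ x ∈ Ioo a b, 0 ≤ f x) : f' ≤ 0 := by
  have := hasDerivWithinAt_iff_tendsto_slope' (s := Iio b) (lt_irrefl b) |>.mp hf.hasDerivWithinAt
  refine le_of_tendsto this ?_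
  filter_upwards [Ioo_mem_nhdsLT hab] with x hx
  rw [slope_def_field, h0, sub_zero]
  exact div_nonpos_of_nonneg_of_nonpos (h x hx) (sub_nonpos.mpr hx.2.le)

/-! ### The strong maximum principle on a graph -/

namespace MetricGraph

variable {V E H : Type*} {Γ : MetricGraph V E H}

theorem IsConnected.forall_of_forall_edge (hΓ : Γ.IsConnected) {P : V → Prop}
    (h : ∀ e, P (Γ.src e) ↔ P (Γ.tgt e)) {v : V} (hv : P v) (w : V) : P w := by
  obtain ⟨p⟩ := hΓ.preconnected v w
  induction p with
  | nil => exact hv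
  | cons hadj _ ih =>
    refine ih ?_
    rw [SimpleGraph.fromRel_adj] at hadj
    obtain ⟨_, ⟨e, rfl, rfl⟩ | ⟨e, rfl, rfl⟩⟩ := hadj
    exacts [(h e).mp hv, (h e).mpr hv]

variable [Fintype E] [Fintype H]

open Classical in
/-- A nonnegative solution of a linear second-order equation with Kirchhoff conditions on a
connected graph vanishes identically or nowhere. -/
theorem strong_maximum_principle (hΓ : Γ.IsConnected) {f b w : E ⊕ H → ℝ → ℝ} {p : V → ℝ}
    (hf : ∀ e, ∀ x ∈ Γ.closedEdge e, HasDerivAt (f e) (b e x) x)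
    (hb : ∀ e, ∀ x ∈ Γ.closedEdge e, HasDerivAt (b e) (-(w e x * f e x)) x)
    (hw : ∀ e, ContinuousOn (w e) (Γ.closedEdge e))
    (hp : ∀ e : E, f (.inl e) 0 = p (Γ.src e) ∧ f (.inl e) (Γ.len e) = p (Γ.tgt e))
    (hp' : ∀ h : H, f (.inr h) 0 = p (Γ.root h))
    (hK : ∀ v, (∑ e : E, if Γ.src e = v then b (.inl e) 0 else 0) +
      (∑ e : E, if Γ.tgt e = v then -b (.inl e) (Γ.len e) else 0) +
      (∑ h : H, if Γ.root h = v then b (.inr h) 0 else 0) = 0)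
    (h0 : ∀ e, ∀ x ∈ Γ.closedEdge e, 0 ≤ f e x) :
    (∀ e, ∀ x ∈ Γ.closedEdge e, f e x = 0) ∨ ∀ e, ∀ x ∈ Γ.closedEdge e, 0 < f e x := by
  -- Cauchy uniqueness: a zero with zero slope kills `f` on the whole edge.
  have edge {e : E ⊕ H} {x₀ : ℝ} (hx₀ : x₀ ∈ Γ.closedEdge e) (h1 : f e x₀ = 0) (h2 : b e x₀ = 0) :
      ∀ x ∈ Γ.closedEdge e, f e x = 0 :=
    eq_zero_of_second_order (Γ.ordConnected_closedEdge e) (hf e) (hb e) (hw e) hx₀ h1 h2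
  -- At a vertex where `f` vanishes, `f ≥ 0` makes every outgoing derivative non-negative; their sum
  -- is zero, so each of them is.
  have vertex {v : V} (hv : p v = 0) : (∀ e, Γ.src e = v → b (.inl e) 0 = 0) ∧
      (∀ e, Γ.tgt e = v → b (.inl e) (Γ.len e) = 0) ∧ ∀ h, Γ.root h = v → b (.inr h) 0 = 0 := by
    have n1 : ∀ e ∈ Finset.univ, 0 ≤ if Γ.src e = v then b (.inl e) 0 else 0 := fun e _ => by
      split_ifs with h
      · exact (hf _ _ (Γ.zero_mem_closedEdge (.inl e))).nonneg_of_nonneg_right (Γ.len_pos e)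
          (by rw [(hp e).1, h, hv]) fun x hx => h0 _ _ (Ioo_subset_Icc_self hx)
      · exact le_rfl
    have n2 : ∀ e ∈ Finset.univ, 0 ≤ if Γ.tgt e = v then -b (.inl e) (Γ.len e) else 0 :=
      fun e _ => by
        split_ifs with h
        · exact neg_nonneg.mpr <| (hf _ _ (len_mem_closedEdge e)).nonpos_of_nonneg_left
            (Γ.len_pos e) (by rw [(hp e).2, h, hv]) fun x hx => h0 _ _ (Ioo_subset_Icc_self hx)
        · exact le_rfl
    have n3 : ∀ h ∈ Finset.univ, 0 ≤ if Γ.root h = v then b (.inr h) 0 else 0 := fun h _ => by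
      split_ifs with h'
      · exact (hf _ _ (Γ.zero_mem_closedEdge (.inr h))).nonneg_of_nonneg_right zero_lt_one
          (by rw [hp' h, h', hv]) fun x hx => h0 _ _ (show (0 : ℝ) ≤ x from hx.1.le)
      · exact le_rfl
    have s1 := Finset.sum_nonneg n1
    have s2 := Finset.sum_nonneg n2
    have s3 := Finset.sum_nonneg n3
    have hKv := hK v
    refine ⟨fun e he => ?_, fun e he => ?_, fun h hh => ?_⟩
    · have := (Finset.sum_eq_zero_iff_of_nonneg n1).mp (by linarith) e (Finset.mem_univ _)
      rwa [if_pos he] at this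
    · have := (Finset.sum_eq_zero_iff_of_nonneg n2).mp (by linarith) e (Finset.mem_univ _)
      rwa [if_pos he, neg_eq_zero] at this
    · have := (Finset.sum_eq_zero_iff_of_nonneg n3).mp (by linarith) h (Finset.mem_univ _)
      rwa [if_pos hh] at this
  have src_zero {e : E} (h : p (Γ.src e) = 0) : ∀ x ∈ Γ.closedEdge (.inl e), f (.inl e) x = 0 :=
    edge (Γ.zero_mem_closedEdge (.inl e)) (by rw [(hp e).1, h]) ((vertex h).1 e rfl)
  have tgt_zero {e : E} (h : p (Γ.tgt e) = 0) : ∀ x ∈ Γ.closedEdge (.inl e), f (.inl e) x = 0 :=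
    edge (len_mem_closedEdge e) (by rw [(hp e).2, h]) ((vertex h).2.1 e rfl)
  -- A zero at one vertex spreads along edges to all vertices by connectedness.
  have all_zero {v : V} (hv : p v = 0) : ∀ e, ∀ x ∈ Γ.closedEdge e, f e x = 0 := by
    have hall : ∀ w, p w = 0 := hΓ.forall_of_forall_edge (fun e => ⟨fun h => by
      rw [← (hp e).2]; exact src_zero h _ (len_mem_closedEdge e), fun h => by
      rw [← (hp e).1]; exact tgt_zero h _ (Γ.zero_mem_closedEdge (.inl e))⟩) hv
    intro e
    cases e with
    | inl e => exact src_zero (hall _)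
    | inr h =>
      exact edge (Γ.zero_mem_closedEdge (.inr h)) (by rw [hp', hall]) ((vertex (hall _)).2.2 h rfl)
  by_contra! hcon
  obtain ⟨⟨e₁, x₁, hx₁, hne⟩, e, x, hx, hle⟩ := hcon
  have hzero : f e x = 0 := le_antisymm hle (h0 e x hx)
  suffices ∃ v, p v = 0 by
    obtain ⟨v, hv⟩ := this
    exact hne (all_zero hv e₁ x₁ hx₁)
  -- An interior zero is a minimum, hence has zero slope, and so propagates to the vertex at `0`.
  have interior (hxo : x ∈ Γ.openEdge e) : f e 0 = 0 := by
    refine edge hx hzero (IsLocalMin.hasDerivAt_eq_zero ?_ (hf e x hx)) 0 (Γ.zero_mem_closedEdge e)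
    filter_upwards [(Γ.isOpen_openEdge e).mem_nhds hxo] with y hy
    rw [hzero]
    exact h0 e y (Γ.openEdge_subset_closedEdge e hy)
  cases e with
  | inl e =>
    rcases eq_or_lt_of_le hx.1 with h | h
    · exact ⟨Γ.src e, by rw [← (hp e).1]; rwa [← h] at hzero⟩
    · rcases eq_or_lt_of_le hx.2 with h' | h'
      · exact ⟨Γ.tgt e, by rw [← (hp e).2, ← h', hzero]⟩
      · exact ⟨Γ.src e, by rw [← (hp e).1, interior ⟨h, h'⟩]⟩
  | inr h' =>
    refine ⟨Γ.root h', ?_⟩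
    rw [← hp' h']
    rcases eq_or_lt_of_le (show (0 : ℝ) ≤ x from hx) with h | h
    · rwa [← h] at hzero
    · exact interior h

end MetricGraph

/-! ### Positivity of ground states -/

/-- Replacement of the real part by its absolute value. -/
def absRe (z : ℂ) : ℂ := ⟨|z.re|, z.im⟩

theorem norm_absRe (z : ℂ) : ‖absRe z‖ = ‖z‖ := by
  simp only [Complex.norm_def, Complex.normSq_apply, absRe, abs_mul_abs_self]

theorem absRe_eq (z : ℂ) : absRe z = ((|z.re| : ℝ) : ℂ) + (z.im : ℂ) * Complex.I := by
  simp [absRe, Complex.ext_iff]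

theorem continuous_absRe : Continuous absRe := by
  rw [funext absRe_eq]
  fun_prop

/-- The derivative of `absRe ∘ u` at points where `u = z`, given that `u` has derivative `w`. -/
noncomputable def absReDeriv (z w : ℂ) : ℂ := if 0 ≤ z.re then w else ⟨-w.re, w.im⟩

theorem norm_absReDeriv (z w : ℂ) : ‖absReDeriv z w‖ = ‖w‖ := by
  unfold absReDeriv
  split_ifs
  · rfl
  · simp [Complex.norm_def, Complex.normSq_apply]

theorem absReDeriv_eq (z w : ℂ) :
    absReDeriv z w = (((if 0 ≤ z.re then 1 else -1) * w.re : ℝ) : ℂ) + (w.im : ℂ) * Complex.I := by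
  unfold absReDeriv
  split_ifs <;> simp [Complex.ext_iff]

/-- At a zero of `a` with zero slope, `a` is `o(y - x)`, hence so is `|a|`; away from zeros the sign
is locally constant. -/
theorem hasDerivAt_abs_comp {a : ℝ → ℝ} {a' x : ℝ} (h : HasDerivAt a a' x) (h0 : a x ≠ 0 ∨ a' = 0) :
    HasDerivAt (fun y => |a y|) ((if 0 ≤ a x then 1 else -1) * a') x := by
  by_cases hx : a x = 0
  · have ha' : a' = 0 := h0.resolve_left (not_not.mpr hx)
    subst ha'
    rw [hasDerivAt_iff_isLittleO] at h ⊢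
    simp only [hx, abs_zero, sub_zero, mul_zero, smul_zero] at h ⊢
    exact h.norm_left
  · rcases lt_or_gt_of_ne hx with hneg | hpos
    · rw [if_neg hneg.not_ge, neg_one_mul]
      refine h.fun_neg.congr_of_eventuallyEq ?_
      filter_upwards [h.continuousAt.eventually_lt continuousAt_const hneg] with y hy
      exact abs_of_neg hy
    · rw [if_pos hpos.le, one_mul]
      refine h.congr_of_eventuallyEq ?_
      filter_upwards [continuousAt_const.eventually_lt h.continuousAt hpos] with y hy
      exact abs_of_pos hy

/-- A zero with non-zero slope is isolated among the zeros, and a subset of the line has only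
countably many such points. -/
theorem countable_zeros_of_deriv_ne_zero {a a' : ℝ → ℝ} (h : ∀ x, HasDerivAt a (a' x) x) :
    {x | a x = 0 ∧ a' x ≠ 0}.Countable := by
  refine (countable_setOfPred_isolated_right_within (s := {x | a x = 0})).mono ?_
  rintro x ⟨hx, hx'⟩
  refine ⟨hx, ?_⟩
  rw [← Filter.empty_mem_iff_bot]
  have h1 : ∀ᶠ z in nhdsWithin x ({x | a x = 0} ∩ Ioi x), a z ≠ 0 :=
    ((h x).eventually_ne hx').filter_mono (nhdsWithin_mono x fun z hz => ne_of_gt hz.2)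
  filter_upwards [h1, self_mem_nhdsWithin] with z hz hz' using hz hz'.1

theorem hasDerivAt_absRe {u : ℝ → ℂ} {w : ℂ} {x : ℝ} (h : HasDerivAt u w x)
    (h0 : (u x).re ≠ 0 ∨ w.re = 0) : HasDerivAt (fun y => absRe (u y)) (absReDeriv (u x) w) x := by
  have hre : HasDerivAt (fun y => (u y).re) w.re x := Complex.reCLM.hasFDerivAt.comp_hasDerivAt x h
  have him : HasDerivAt (fun y => (u y).im) w.im x := Complex.imCLM.hasFDerivAt.comp_hasDerivAt x h
  have hsum := (hasDerivAt_abs_comp hre h0).ofReal_comp.fun_add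
    (him.ofReal_comp.mul_const Complex.I)
  rw [absReDeriv_eq]
  exact hsum.congr_of_eventuallyEq (.of_forall fun y => absRe_eq (u y))

/-- Since `u` is `C¹`, `absRe ∘ u` is differentiable except at the countably many transversal zeros
of `Re u`, so it is the primitive of its pointwise derivative. -/
theorem hasWeakDeriv_absRe {I : Set ℝ} (hI : IsOpen I) {u g : ℝ → ℂ}
    (h : ∀ x, HasDerivAt u (g x) x) (hg : Continuous g) :
    HasWeakDeriv I (fun x => absRe (u x)) (fun x => absReDeriv (u x) (g x)) := by
  have hu : Continuous u := continuous_iff_continuousAt.mpr fun x => (h x).continuousAt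
  refine HasWeakDeriv.of_hasDerivAt_off_countable hI (s := {x | (u x).re = 0 ∧ (g x).re ≠ 0})
    (countable_zeros_of_deriv_ne_zero fun x => Complex.reCLM.hasFDerivAt.comp_hasDerivAt x (h x))
    (continuous_absRe.comp hu) (fun x hx => hasDerivAt_absRe (h x) ?_) ?_
  · by_contra! hcon
    exact hx hcon
  · refine hg.locallyIntegrable.mono (Measurable.aestronglyMeasurable ?_)
      (.of_forall fun x => (norm_absReDeriv _ _).le)
    simp only [absReDeriv_eq]
    have hu' := Complex.measurable_re.comp hu.measurable
    have hg' := hg.measurable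
    have : Measurable fun x => if 0 ≤ (u x).re then (1 : ℝ) else -1 :=
      Measurable.ite (measurableSet_le measurable_const hu') measurable_const measurable_const
    fun_prop

namespace MetricGraph

variable {V E H : Type*} {Γ : MetricGraph V E H} [Fintype E] [Fintype H] {q : ℝ}
  {Φ Ψ G : E ⊕ H → ℝ → ℂ}

theorem IsGroundState.const_mul (hΦ : Γ.IsGroundState q Φ) {c : ℂ} (hc : ‖c‖ = 1) :
    Γ.IsGroundState q fun e x => c * Φ e x := by
  obtain ⟨g, hg⟩ := Γ.memH1_iff.mp hΦ.1
  refine ⟨(hg.const_mul c).memH1, by rw [mass_const_mul, hc, hΦ.2.1]; ring, fun U hU hm => ?_⟩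
  rw [(hg.const_mul c).energy_eq, kinetic_const_mul, quartic_const_mul, hc, one_pow, one_pow,
    one_mul, one_mul, ← hg.energy_eq]
  exact hΦ.2.2 U hU hm

theorem quartic_congr {U W : E ⊕ H → ℝ → ℂ}
    (h : ∀ e, ∀ x ∈ Γ.closedEdge e, ‖U e x‖ = ‖W e x‖) : Γ.quartic U = Γ.quartic W :=
  Finset.sum_congr rfl fun e _ => setIntegral_congr_fun (Γ.measurableSet_openEdge e) fun x hx => by
    simp only [h e x (Γ.openEdge_subset_closedEdge e hx)]

theorem mass_congr {U W : E ⊕ H → ℝ → ℂ}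
    (h : ∀ e, ∀ x ∈ Γ.closedEdge e, ‖U e x‖ = ‖W e x‖) : Γ.mass U = Γ.mass W :=
  Finset.sum_congr rfl fun e _ => setIntegral_congr_fun (Γ.measurableSet_openEdge e) fun x hx => by
    simp only [h e x (Γ.openEdge_subset_closedEdge e hx)]

/-- The moduli of the function and of its derivative are unchanged, hence so are the mass, the
energy and the quartic term, which determine the multiplier. `U` is built from the extension `Ψ`,
which is `C¹` on the line. -/
theorem IsGroundState.absRe (hq : 0 < q) (hΦ : Γ.IsGroundState q Φ) :
    ∃ U, Γ.IsGroundState q U ∧ Γ.multiplier q U = Γ.multiplier q Φ ∧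
      ∀ e, ∀ x ∈ Γ.closedEdge e, U e x = _root_.absRe (Φ e x) := by
  obtain ⟨Ψ, G, hG, hs⟩ := hΦ.exists_isClassicalSolution hq
  set U : E ⊕ H → ℝ → ℂ := fun e x => _root_.absRe (Ψ e x) with hU
  have hUΦ : ∀ e, ∀ x ∈ Γ.closedEdge e, U e x = _root_.absRe (Φ e x) := fun e x hx => by
    simp only [hU, hs.eqOn e hx]
  have hnorm : ∀ e, ∀ x ∈ Γ.closedEdge e, ‖U e x‖ = ‖Φ e x‖ := fun e x hx => by
    rw [hUΦ e x hx, norm_absRe]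
  have hΨc (e : E ⊕ H) : Continuous (Ψ e) :=
    continuous_iff_continuousAt.mpr fun x => (hs.hasDerivAt e x).continuousAt
  have hw (e : E ⊕ H) := hasWeakDeriv_absRe (Γ.isOpen_openEdge e) (hs.hasDerivAt e)
    (hs.continuous_deriv e)
  have hH1 : Γ.HasH1Deriv U fun e x => absReDeriv (Ψ e x) (G e x) := by
    refine ⟨hw, fun e => ?_, fun e => ?_, fun e => ?_, ?_⟩
    · refine (hG.memLp e).congr_norm (continuous_absRe.comp (hΨc e)).aestronglyMeasurable ?_
      filter_upwards [Γ.ae_mem_closedEdge e] with x hx using (hnorm e x hx).symm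
    · refine (hG.memLp_deriv e).congr_norm ?_ (.of_forall fun x => (norm_absReDeriv _ _).symm)
      exact LocallyIntegrableOn.aestronglyMeasurable (hw e).2.1
    · exact (continuous_absRe.comp (hΨc e)).continuousOn
    · obtain ⟨_, p, h1, h2⟩ := hΦ.1.2
      refine ⟨fun v => _root_.absRe (p v), fun e => ⟨?_, ?_⟩, fun h => ?_⟩
      · rw [hUΦ _ _ (Γ.zero_mem_closedEdge (.inl e)), (h1 e).1]
      · rw [hUΦ _ _ (len_mem_closedEdge e), (h1 e).2]
      · rw [hUΦ _ _ (Γ.zero_mem_closedEdge (.inr h)), h2]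
  have hquart := quartic_congr hnorm
  have hen : Γ.energy U = Γ.energy Φ := by
    rw [hH1.energy_eq, hG.energy_eq, hquart]
    simp only [kinetic, norm_absReDeriv]
  exact ⟨U, ⟨hH1.memH1, (mass_congr hnorm).trans hΦ.2.1, fun W hW hm => hen ▸ hΦ.2.2 W hW hm⟩,
    by rw [multiplier, multiplier, hen, hquart], hUΦ⟩

/-- Both `Φ` and `absRe Φ` have the same modulus and multiplier, so the cubic equation is for both
the same linear one. The maximum principle applies to `f = |Re Φ| + Re Φ ≥ 0`: `f = 0` means `Re Φ ≤
0`, and `f > 0` means `Re Φ > 0`. -/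
theorem IsGroundState.re_nonpos_or_re_pos (hΓ : Γ.IsConnected) (hq : 0 < q)
    (hΦ : Γ.IsGroundState q Φ) :
    (∀ e, ∀ x ∈ Γ.closedEdge e, (Φ e x).re ≤ 0) ∨ ∀ e, ∀ x ∈ Γ.closedEdge e, 0 < (Φ e x).re := by
  obtain ⟨U, hUg, hUm, hU⟩ := hΦ.absRe hq
  obtain ⟨Ψ, G, -, hs⟩ := hΦ.exists_isClassicalSolution hq
  obtain ⟨Ψ', G', -, hs'⟩ := hUg.exists_isClassicalSolution hq
  obtain ⟨-, p, hp1, hp2⟩ := hΦ.1.2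
  rw [hUm] at hs'
  set Λ := Γ.multiplier q Φ
  have hΨΦ (e : E ⊕ H) (x : ℝ) (hx : x ∈ Γ.closedEdge e) : Ψ e x = Φ e x := (hs.eqOn e hx).symm
  have hΨU (e : E ⊕ H) (x : ℝ) (hx : x ∈ Γ.closedEdge e) : Ψ' e x = _root_.absRe (Φ e x) :=
    (hs'.eqOn e hx).symm.trans (hU e x hx)
  have hval (e : E ⊕ H) (x : ℝ) (hx : x ∈ Γ.closedEdge e) :
      (Ψ' e x + Ψ e x).re = |(Φ e x).re| + (Φ e x).re := by
    rw [hΨU e x hx, hΨΦ e x hx]; rfl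
  have hre {u : ℝ → ℂ} {w : ℂ} {x : ℝ} (h : HasDerivAt u w x) :
      HasDerivAt (fun y => (u y).re) w.re x := Complex.reCLM.hasFDerivAt.comp_hasDerivAt x h
  have hsmp := strong_maximum_principle hΓ (f := fun e x => (Ψ' e x + Ψ e x).re)
    (b := fun e x => (G' e x + G e x).re) (w := fun e x => 2 * ‖Φ e x‖ ^ 2 + Λ)
    (p := fun v => |(p v).re| + (p v).re)
    (fun e x _ => hre ((hs'.hasDerivAt e x).fun_add (hs.hasDerivAt e x)))
    (fun e x hx => by
      convert hre ((hs'.hasDerivAt_deriv e x hx).fun_add (hs.hasDerivAt_deriv e x hx)) using 1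
      rw [hΨU e x hx, hΨΦ e x hx, norm_absRe]
      simp only [Complex.add_re, Complex.neg_re, Complex.smul_re, smul_eq_mul]
      ring)
    (fun e => by
      have := hΦ.1.2.1 e
      fun_prop)
    (fun e => ⟨by rw [hval _ _ (Γ.zero_mem_closedEdge (.inl e)), (hp1 e).1],
      by rw [hval _ _ (len_mem_closedEdge e), (hp1 e).2]⟩)
    (fun h => by rw [hval _ _ (Γ.zero_mem_closedEdge (.inr h)), hp2])
    (fun v => by
      have h := congrArg Complex.re (congrArg₂ (· + ·) (hs'.kirchhoff v) (hs.kirchhoff v))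
      simp only [Complex.add_re, Complex.re_sum, apply_ite Complex.re, Complex.neg_re,
        Complex.zero_re, add_zero] at h
      refine Eq.trans ?_ h
      simp only [Complex.add_re, neg_add, ← Finset.sum_filter, Finset.sum_add_distrib]
      ring)
    (fun e x hx => by
      rw [hval e x hx]
      linarith [neg_abs_le (Φ e x).re])
  rcases hsmp with h | h
  · left
    intro e x hx
    have := h e x hx
    rw [hval e x hx] at this
    linarith [abs_nonneg (Φ e x).re]
  · right
    intro e x hx
    have := h e x hx
    rw [hval e x hx] at this
    by_contra hcon
    rw [abs_of_nonpos (not_lt.mp hcon)] at this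
    linarith

/-- Positive mass gives a point where `Φ ≠ 0`; choose the phase `c` making `cΦ` positive there. The
dichotomy for `i c Φ` and `-i c Φ`, whose real parts vanish at that point, forces `Im (cΦ) = 0`; for
`cΦ` itself it gives positivity. -/
theorem IsGroundState.exists_pos (hΓ : Γ.IsConnected) (hq : 0 < q) (hΦ : Γ.IsGroundState q Φ) :
    ∃ c : ℂ, ‖c‖ = 1 ∧ ∀ e, ∀ x ∈ Γ.closedEdge e, (c * Φ e x).im = 0 ∧ 0 < (c * Φ e x).re := by
  obtain ⟨e₀, x₀, hx₀, hne⟩ : ∃ e, ∃ x ∈ Γ.closedEdge e, Φ e x ≠ 0 := by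
    by_contra! hcon
    have h0 := mass_congr (Γ := Γ) (U := Φ) (W := fun _ _ => 0) fun e x hx => by rw [hcon e x hx]
    rw [hΦ.2.1] at h0
    simp [mass] at h0
    exact hq.ne' h0
  have hn : (‖Φ e₀ x₀‖ : ℂ) ≠ 0 := by simpa using hne
  set c : ℂ := (starRingEnd ℂ) (Φ e₀ x₀) / ‖Φ e₀ x₀‖ with hc
  have hc1 : ‖c‖ = 1 := by
    rw [hc, norm_div, Complex.norm_conj, Complex.norm_real, norm_norm, div_self (by simpa using hne)]
  have hcx : c * Φ e₀ x₀ = ‖Φ e₀ x₀‖ := by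
    rw [hc, div_mul_eq_mul_div, mul_comm, Complex.mul_conj, Complex.normSq_eq_norm_sq]
    push_cast
    field_simp
  have him (d : ℂ) (hd : ‖d‖ = 1) (hd' : (d * (c * Φ e₀ x₀)).re = 0) :
      ∀ e, ∀ x ∈ Γ.closedEdge e, (d * (c * Φ e x)).re ≤ 0 :=
    (((hΦ.const_mul hc1).const_mul hd).re_nonpos_or_re_pos hΓ hq).resolve_right fun h => by
      have := h e₀ x₀ hx₀
      rw [hd'] at this
      exact lt_irrefl _ this
  have h1 := him Complex.I (by simp) (by rw [hcx]; simp)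
  have h2 := him (-Complex.I) (by simp) (by rw [hcx]; simp)
  have h3 := ((hΦ.const_mul hc1).re_nonpos_or_re_pos hΓ hq).resolve_left fun h => by
    have := h e₀ x₀ hx₀
    rw [hcx, Complex.ofReal_re] at this
    exact hne (norm_le_zero_iff.mp this)
  refine ⟨c, hc1, fun e x hx => ⟨le_antisymm ?_ ?_, h3 e x hx⟩⟩
  · have := h2 e x hx
    rw [neg_mul, Complex.neg_re, Complex.I_mul_re, neg_neg] at this
    exact this
  · have := h1 e x hx
    rw [Complex.I_mul_re] at this
    linarith

end MetricGraph

/-! ### Reflection of a function on a subinterval -/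

/-- The map of the line that reflects `[a, b]` and fixes every other point. -/
noncomputable def reflectIcc (a b x : ℝ) : ℝ := if x ∈ Icc a b then a + b - x else x

theorem reflectIcc_of_mem {a b x : ℝ} (h : x ∈ Icc a b) : reflectIcc a b x = a + b - x := if_pos h

theorem reflectIcc_of_notMem {a b x : ℝ} (h : x ∉ Icc a b) : reflectIcc a b x = x := if_neg h

theorem add_sub_mem_Icc_iff {a b x : ℝ} : a + b - x ∈ Icc a b ↔ x ∈ Icc a b := by
  constructor <;> rintro ⟨h1, h2⟩ <;> constructor <;> linarith

theorem reflectIcc_involutive (a b : ℝ) : Function.Involutive (reflectIcc a b) := fun x => by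
  by_cases h : x ∈ Icc a b
  · rw [reflectIcc_of_mem h, reflectIcc_of_mem (add_sub_mem_Icc_iff.mpr h)]; ring
  · rw [reflectIcc_of_notMem h, reflectIcc_of_notMem h]

theorem measurable_reflectIcc (a b : ℝ) : Measurable (reflectIcc a b) :=
  Measurable.ite measurableSet_Icc (by fun_prop) measurable_id

theorem reflectIcc_mem_iff {a b x : ℝ} {I : Set ℝ} (hI : Icc a b ⊆ I) :
    reflectIcc a b x ∈ I ↔ x ∈ I := by
  by_cases h : x ∈ Icc a b
  · rw [reflectIcc_of_mem h]
    exact iff_of_true (hI (add_sub_mem_Icc_iff.mpr h)) (hI h)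
  · rw [reflectIcc_of_notMem h]

theorem measurePreserving_reflectIcc (a b : ℝ) :
    MeasurePreserving (reflectIcc a b) volume volume := by
  refine ⟨measurable_reflectIcc a b, Measure.ext fun s hs => ?_⟩
  rw [Measure.map_apply (measurable_reflectIcc a b) hs,
    ← measure_inter_add_sdiff (reflectIcc a b ⁻¹' s) measurableSet_Icc (t := Icc a b),
    ← measure_inter_add_sdiff s measurableSet_Icc (t := Icc a b)]
  congr 1
  · rw [← (Measure.measurePreserving_sub_left volume (a + b)).measure_preimage
      (hs.inter measurableSet_Icc).nullMeasurableSet]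
    congr 1
    ext x
    simp only [mem_inter_iff, mem_preimage, add_sub_mem_Icc_iff]
    exact and_congr_left fun h => by rw [reflectIcc_of_mem h]
  · congr 1
    ext x
    simp only [mem_sdiff, mem_preimage]
    exact and_congr_left fun h => by rw [reflectIcc_of_notMem h]

theorem measurePreserving_reflectIcc_restrict {a b : ℝ} {I : Set ℝ} (hI : Icc a b ⊆ I)
    (hIm : MeasurableSet I) :
    MeasurePreserving (reflectIcc a b) (volume.restrict I) (volume.restrict I) := by
  have := (measurePreserving_reflectIcc a b).restrict_preimage hIm
  rwa [show reflectIcc a b ⁻¹' I = I from ext fun x => reflectIcc_mem_iff hI] at this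

theorem setIntegral_comp_reflectIcc {a b : ℝ} {I : Set ℝ} (hI : Icc a b ⊆ I)
    (hIm : MeasurableSet I) (F : ℝ → ℝ) : ∫ x in I, F (reflectIcc a b x) = ∫ x in I, F x :=
  (measurePreserving_reflectIcc_restrict hI hIm).integral_comp
    (MeasurableEquiv.ofInvolutive _ (reflectIcc_involutive a b)
      (measurable_reflectIcc a b)).measurableEmbedding F

theorem continuous_comp_reflectIcc {u : ℝ → ℂ} (hu : Continuous u) {a b : ℝ} (hab : a < b)
    (h : u a = u b) : Continuous fun x => u (reflectIcc a b x) := by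
  have : (fun x => u (reflectIcc a b x)) = fun x => if x ∈ Icc a b then u (a + b - x) else u x := by
    ext x; unfold reflectIcc; split_ifs <;> rfl
  rw [this]
  refine Continuous.if (fun x hx => ?_) (by fun_prop) hu
  have hx' : x ∈ frontier (Icc a b) := hx
  rw [frontier_Icc hab.le] at hx'
  rcases hx' with rfl | rfl
  · rw [add_sub_cancel_left, h]
  · rw [add_sub_cancel_right, h]

/-- The derivative of `u ∘ reflectIcc a b` off the end-points, when `g` is that of `u`. -/
noncomputable def reflectDeriv (a b : ℝ) (g : ℝ → ℂ) (x : ℝ) : ℂ :=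
  (if x ∈ Icc a b then (-1 : ℂ) else 1) * g (reflectIcc a b x)

theorem norm_reflectDeriv (a b : ℝ) (g : ℝ → ℂ) (x : ℝ) :
    ‖reflectDeriv a b g x‖ = ‖g (reflectIcc a b x)‖ := by
  unfold reflectDeriv
  split_ifs <;> simp

/-- Equal values at `a` and `b` make the reflected function continuous, so it only has corners at
these two points. -/
theorem hasWeakDeriv_comp_reflectIcc {I : Set ℝ} (hI : IsOpen I) {u g : ℝ → ℂ}
    (hd : ∀ x, HasDerivAt u (g x) x) (hg : Continuous g) {a b : ℝ} (hab : a < b) (h : u a = u b) :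
    HasWeakDeriv I (fun x => u (reflectIcc a b x)) (reflectDeriv a b g) := by
  have hu : Continuous u := continuous_iff_continuousAt.mpr fun x => (hd x).continuousAt
  refine HasWeakDeriv.of_hasDerivAt_off_countable hI (s := {a, b}) (by simp)
    (continuous_comp_reflectIcc hu hab h) (fun x hx => ?_) ?_
  · by_cases hxI : x ∈ Icc a b
    · have hxo : x ∈ Ioo a b := by
        simp only [mem_insert_iff, mem_singleton_iff, not_or] at hx
        exact ⟨lt_of_le_of_ne hxI.1 (Ne.symm hx.1), lt_of_le_of_ne hxI.2 hx.2⟩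
      have h1 : HasDerivAt (fun y => u (a + b - y)) (-g (a + b - x)) x := by
        have := (hd (a + b - x)).scomp x ((hasDerivAt_id x).const_sub (a + b))
        simpa [Function.comp_def] using this
      rw [reflectDeriv, if_pos hxI, reflectIcc_of_mem hxI, neg_one_mul]
      refine h1.congr_of_eventuallyEq ?_
      filter_upwards [Ioo_mem_nhds hxo.1 hxo.2] with y hy
      rw [reflectIcc_of_mem (Ioo_subset_Icc_self hy)]
    · rw [reflectDeriv, if_neg hxI, reflectIcc_of_notMem hxI, one_mul]
      refine (hd x).congr_of_eventuallyEq ?_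
      filter_upwards [isClosed_Icc.isOpen_compl.mem_nhds hxI] with y hy
      rw [reflectIcc_of_notMem hy]
  · have hbound : Continuous fun x => ‖g x‖ + ‖g (a + b - x)‖ := by fun_prop
    refine hbound.locallyIntegrable.mono (Measurable.aestronglyMeasurable ?_)
      (.of_forall fun x => ?_)
    · exact (Measurable.ite measurableSet_Icc measurable_const measurable_const).mul
        (hg.measurable.comp (measurable_reflectIcc a b))
    · rw [norm_reflectDeriv, Real.norm_of_nonneg (by positivity)]
      unfold reflectIcc
      split_ifs
      · exact le_add_of_nonneg_left (norm_nonneg _)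
      · exact le_add_of_nonneg_right (norm_nonneg _)

namespace MetricGraph

variable {V E H : Type*} {Γ : MetricGraph V E H} [Fintype E] [Fintype H] {q Λ : ℝ}
  {Φ Ψ G : E ⊕ H → ℝ → ℂ}

/-- Reflecting a ground state between two points of an edge where it takes the same value gives a
ground state. -/
theorem IsGroundState.reflect [DecidableEq (E ⊕ H)] (hΦ : Γ.IsGroundState q Φ)
    (hG : Γ.HasH1Deriv Φ G) (hs : Γ.IsClassicalSolution Λ Φ Ψ G) {e : E ⊕ H} {a b : ℝ}
    (ha : a ∈ Γ.openEdge e) (hb : b ∈ Γ.openEdge e) (hab : a < b) (h : Ψ e a = Ψ e b) :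
    Γ.IsGroundState q (Function.update Φ e fun x => Ψ e (reflectIcc a b x)) := by
  have hsub : Icc a b ⊆ Γ.openEdge e := (Γ.ordConnected_openEdge e).out ha hb
  have hIm := Γ.measurableSet_openEdge e
  have hmp := measurePreserving_reflectIcc_restrict hsub hIm
  have hΨc : Continuous (Ψ e) :=
    continuous_iff_continuousAt.mpr fun x => (hs.hasDerivAt e x).continuousAt
  have hΨΦ : ∀ᵐ x ∂volume.restrict (Γ.openEdge e), Φ e x = Ψ e x :=
    (Γ.ae_mem_closedEdge e).mono fun x hx => hs.eqOn e hx
  set U := Function.update Φ e fun x => Ψ e (reflectIcc a b x) with hU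
  set k := Function.update G e (reflectDeriv a b (G e)) with hk
  have hUe : U e = fun x => Ψ e (reflectIcc a b x) := Function.update_self ..
  have hke : k e = reflectDeriv a b (G e) := Function.update_self ..
  have hUne {e' : E ⊕ H} (hne : e' ≠ e) : U e' = Φ e' := Function.update_of_ne hne ..
  have hkne {e' : E ⊕ H} (hne : e' ≠ e) : k e' = G e' := Function.update_of_ne hne ..
  -- The reflected interval lies in the open edge, so vertex values are untouched and continuity on
  -- the graph survives.
  have hend {e' : E ⊕ H} {x : ℝ} (hx : x ∈ Γ.closedEdge e') (hx' : x ∉ Γ.openEdge e') :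
      U e' x = Φ e' x := by
    by_cases hne : e' = e
    · subst hne
      rw [hUe, hs.eqOn _ hx]
      exact congrArg (Ψ e') (reflectIcc_of_notMem fun hmem => hx' (hsub hmem))
    · rw [hUne hne]
  have hw : HasWeakDeriv (Γ.openEdge e) (U e) (k e) := by
    rw [hUe, hke]
    exact hasWeakDeriv_comp_reflectIcc (Γ.isOpen_openEdge e) (hs.hasDerivAt e)
      (hs.continuous_deriv e) hab h
  have hH1 : Γ.HasH1Deriv U k := by
    refine ⟨fun e' => ?_, fun e' => ?_, fun e' => ?_, fun e' => ?_, ?_⟩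
    · by_cases hne : e' = e
      · subst hne; exact hw
      · rw [hUne hne, hkne hne]; exact hG.hasWeakDeriv e'
    · by_cases hne : e' = e
      · subst hne
        rw [hUe]
        exact ((hG.memLp e').ae_eq hΨΦ).comp_measurePreserving hmp
      · rw [hUne hne]; exact hG.memLp e'
    · by_cases hne : e' = e
      · subst hne
        refine ((hG.memLp_deriv e').comp_measurePreserving hmp).congr_norm
          (LocallyIntegrableOn.aestronglyMeasurable hw.2.1) (.of_forall fun x => ?_)
        rw [hke, norm_reflectDeriv]; rfl
      · rw [hkne hne]; exact hG.memLp_deriv e'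
    · by_cases hne : e' = e
      · subst hne
        rw [hUe]
        exact (continuous_comp_reflectIcc hΨc hab h).continuousOn
      · rw [hUne hne]; exact hG.isContinuous.1 e'
    · obtain ⟨-, p, h1, h2⟩ := hG.isContinuous
      refine ⟨p, fun e' => ⟨?_, ?_⟩, fun h' => ?_⟩
      · rw [hend (Γ.zero_mem_closedEdge (.inl e')) fun hx => lt_irrefl _ hx.1, (h1 e').1]
      · rw [hend (len_mem_closedEdge e') fun hx => lt_irrefl _ hx.2, (h1 e').2]
      · rw [hend (Γ.zero_mem_closedEdge (.inr h')) fun hx => lt_irrefl (0 : ℝ) hx, h2]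
  have hint (n : ℕ) (e' : E ⊕ H) :
      ∫ x in Γ.openEdge e', ‖U e' x‖ ^ n = ∫ x in Γ.openEdge e', ‖Φ e' x‖ ^ n := by
    by_cases hne : e' = e
    · subst hne
      rw [hUe]
      refine (setIntegral_comp_reflectIcc hsub hIm fun x => ‖Ψ e' x‖ ^ n).trans ?_
      exact integral_congr_ae (hΨΦ.mono fun x hx => by simp only [hx])
    · rw [hUne hne]
  have hkin (e' : E ⊕ H) :
      ∫ x in Γ.openEdge e', ‖k e' x‖ ^ 2 = ∫ x in Γ.openEdge e', ‖G e' x‖ ^ 2 := by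
    by_cases hne : e' = e
    · subst hne
      simp only [hke, norm_reflectDeriv]
      exact setIntegral_comp_reflectIcc hsub hIm fun x => ‖G e' x‖ ^ 2
    · rw [hkne hne]
  have hen : Γ.energy U = Γ.energy Φ := by
    rw [hH1.energy_eq, hG.energy_eq]
    simp only [kinetic, quartic, hint, hkin]
  refine ⟨hH1.memH1, ?_, fun W hW hm => hen ▸ hΦ.2.2 W hW hm⟩
  rw [← hΦ.2.1]
  simp only [mass, hint]

/-- The reflected function is again a ground state, so by regularity it is differentiable at `a`.
Its left derivative there is that of `Φ` at `a`; its right derivative is minus that of `Φ` at `b`.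
-/
theorem IsGroundState.deriv_eq_neg_deriv (hq : 0 < q) (hΦ : Γ.IsGroundState q Φ)
    (hG : Γ.HasH1Deriv Φ G) (hs : Γ.IsClassicalSolution Λ Φ Ψ G) {e : E ⊕ H} {a b : ℝ}
    (ha : a ∈ Γ.openEdge e) (hb : b ∈ Γ.openEdge e) (hab : a < b) (h : Ψ e a = Ψ e b) :
    G e a = -G e b := by
  classical
  have ha0 : 0 < a := by
    cases e
    exacts [ha.1, ha]
  obtain ⟨Ψ', G', -, hs'⟩ := (hΦ.reflect hG hs ha hb hab h).exists_isClassicalSolution hq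
  have hsubc {x y : ℝ} (hx : x ∈ Γ.closedEdge e) (hy : y ∈ Γ.closedEdge e) :
      Icc x y ⊆ Γ.closedEdge e := (Γ.ordConnected_closedEdge e).out hx hy
  have hac := Γ.openEdge_subset_closedEdge e ha
  have hbc := Γ.openEdge_subset_closedEdge e hb
  have hval {x : ℝ} (hx : x ∈ Γ.closedEdge e) : Ψ' e x = Ψ e (reflectIcc a b x) := by
    rw [← hs'.eqOn e hx, Function.update_self]
  have hleft : G' e a = G e a := by
    have heq : EqOn (Ψ' e) (Ψ e) (Icc 0 a) := fun x hx => by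
      rw [hval (hsubc (Γ.zero_mem_closedEdge e) hac hx)]
      rcases eq_or_lt_of_le hx.2 with rfl | hlt
      · rw [reflectIcc_of_mem ⟨le_rfl, hab.le⟩, add_sub_cancel_left, h]
      · rw [reflectIcc_of_notMem fun hmem => hlt.not_ge hmem.1]
    have hmem : a ∈ Icc 0 a := ⟨ha0.le, le_rfl⟩
    exact (uniqueDiffOn_Icc ha0 a hmem).eq_deriv _ (hs'.hasDerivAt e a).hasDerivWithinAt
      ((hs.hasDerivAt e a).hasDerivWithinAt.congr heq (heq hmem))
  have hright : G' e a = -G e b := by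
    have heq : EqOn (Ψ' e) (fun x => Ψ e (a + b - x)) (Icc a b) := fun x hx => by
      rw [hval (hsubc hac hbc hx), reflectIcc_of_mem hx]
    have hmem : a ∈ Icc a b := ⟨le_rfl, hab.le⟩
    have h1 : HasDerivAt (fun y => Ψ e (a + b - y)) (-G e b) a := by
      have := (hs.hasDerivAt e (a + b - a)).scomp a ((hasDerivAt_id a).const_sub (a + b))
      simpa [Function.comp_def] using this
    exact (uniqueDiffOn_Icc hab a hmem).eq_deriv _ (hs'.hasDerivAt e a).hasDerivWithinAt
      (h1.hasDerivWithinAt.congr heq (heq hmem))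
  rw [← hleft, hright]

end MetricGraph

/-! ### Non-oscillation -/

/-- The slope `v` has a negative derivative at its zero `y`, so it changes from positive to negative
there, and the mean value theorem compares values. The bound `d` serves to keep the neighbourhoods
of two maxima apart. -/
theorem exists_lt_of_strict_max {u v : ℝ → ℝ} {I : Set ℝ} (hI : IsOpen I)
    (hu : ∀ x ∈ I, HasDerivAt u (v x) x) {y m : ℝ} (hy : y ∈ I) (hv : HasDerivAt v m y)
    (hv0 : v y = 0) (hm : m < 0) {d : ℝ} (hd : 0 < d) :
    ∃ r, 0 < r ∧ r < d ∧ Icc (y - r) (y + r) ⊆ I ∧ u (y - r) < u y ∧ u (y + r) < u y ∧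
      ∀ x ∈ Ico (y - r) y, 0 < v x := by
  have hsign := eventually_nhdsWithin_sign_eq_of_deriv_neg (by rwa [hv.deriv]) hv0
  obtain ⟨ε, hε, hball⟩ := Metric.eventually_nhds_iff_ball.mp (hsign.and (hI.mem_nhds hy))
  set r := min (ε / 2) (d / 2)
  have hr : 0 < r := by positivity
  have hrε : r < ε := (min_le_left _ _).trans_lt (by linarith)
  have hmem {x : ℝ} (hx : x ∈ Icc (y - r) (y + r)) : x ∈ Metric.ball y ε := by
    rw [Real.ball_eq_Ioo]
    constructor <;> linarith [hx.1, hx.2]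
  have hsub : Icc (y - r) (y + r) ⊆ I := fun x hx => (hball x (hmem hx)).2
  have hpos : ∀ x ∈ Ico (y - r) y, 0 < v x := fun x hx => by
    have := (hball x (hmem ⟨hx.1, by linarith [hx.2]⟩)).1
    rw [sign_pos (sub_pos.mpr hx.2)] at this
    exact sign_eq_one_iff.mp this
  have hneg : ∀ x ∈ Ioc y (y + r), v x < 0 := fun x hx => by
    have := (hball x (hmem ⟨by linarith [hx.1], hx.2⟩)).1
    rw [sign_neg (sub_neg.mpr hx.1)] at this
    exact sign_eq_neg_one_iff.mp this
  refine ⟨r, hr, (min_le_right _ _).trans_lt (by linarith), hsub, ?_, ?_, hpos⟩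
  · obtain ⟨c, hc, hc'⟩ := exists_hasDerivAt_eq_slope u v (show y - r < y by linarith)
      (fun x hx => (hu x (hsub ⟨hx.1, by linarith [hx.2]⟩)).continuousAt.continuousWithinAt)
      (fun x hx => hu x (hsub ⟨hx.1.le, by linarith [hx.2]⟩))
    have := hpos c ⟨hc.1.le, hc.2⟩
    rw [hc', sub_sub_cancel] at this
    have := (div_pos_iff_of_pos_right hr).mp this
    linarith
  · obtain ⟨c, hc, hc'⟩ := exists_hasDerivAt_eq_slope u v (show y < y + r by linarith)
      (fun x hx => (hu x (hsub ⟨by linarith [hx.1], hx.2⟩)).continuousAt.continuousWithinAt)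
      (fun x hx => hu x (hsub ⟨by linarith [hx.1], hx.2.le⟩))
    have := hneg c ⟨hc.1, hc.2.le⟩
    rw [hc', add_sub_cancel_left] at this
    have := (div_neg_iff.mp this).resolve_left fun h => by linarith [h.2]
    linarith [this.1]

/-- If equal values come with opposite slopes, then a value is not a nondegenerate local maximum
at two different points. -/
theorem false_of_two_strict_max {u v : ℝ → ℝ} {I : Set ℝ} (hI : IsOpen I)
    (hu : ∀ x ∈ I, HasDerivAt u (v x) x)
    (hanti : ∀ x ∈ I, ∀ y ∈ I, x < y → u x = u y → v x = -v y)
    {y₁ y₂ m₁ m₂ : ℝ} (h₁ : y₁ ∈ I) (h₂ : y₂ ∈ I) (h₁₂ : y₁ < y₂) (heq : u y₁ = u y₂)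
    (hv₁ : HasDerivAt v m₁ y₁) (hv₂ : HasDerivAt v m₂ y₂) (hm₁ : m₁ < 0) (hm₂ : m₂ < 0)
    (hv₁0 : v y₁ = 0) (hv₂0 : v y₂ = 0) : False := by
  obtain ⟨r₁, hr₁, hrd₁, hs₁, -, hlt₁, -⟩ := exists_lt_of_strict_max hI hu h₁ hv₁ hv₁0 hm₁
    (d := (y₂ - y₁) / 2) (by linarith)
  obtain ⟨r₂, hr₂, hrd₂, hs₂, hlt₂, hlt₂', hpos⟩ := exists_lt_of_strict_max hI hu h₂ hv₂ hv₂0 hm₂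
    (d := (y₂ - y₁) / 2) (by linarith)
  -- A level just below the common maximum, chosen so that it is taken at some `z₁` right of `y₁`
  -- and at `z₂`, `z₃` on either side of `y₂`.
  set ψ := max (u (y₁ + r₁)) (max (u (y₂ - r₂)) (u (y₂ + r₂)))
  have hψ : ψ < u y₂ := max_lt (heq ▸ hlt₁) (max_lt hlt₂ hlt₂')
  have hψ1 : u (y₁ + r₁) ≤ ψ := le_max_left _ _
  have hψ2 : u (y₂ - r₂) ≤ ψ := (le_max_left _ _).trans (le_max_right _ _)
  have hψ3 : u (y₂ + r₂) ≤ ψ := (le_max_right _ _).trans (le_max_right _ _)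
  have hcont {s : Set ℝ} (hs : s ⊆ I) : ContinuousOn u s :=
    fun x hx => (hu x (hs hx)).continuousAt.continuousWithinAt
  have hs₁' : Icc y₁ (y₁ + r₁) ⊆ I := (Icc_subset_Icc_left (by linarith)).trans hs₁
  have hs₂' : Icc (y₂ - r₂) y₂ ⊆ I := (Icc_subset_Icc_right (by linarith)).trans hs₂
  have hs₃' : Icc y₂ (y₂ + r₂) ⊆ I := (Icc_subset_Icc_left (by linarith)).trans hs₂
  obtain ⟨z₁, hz₁, hz₁ψ⟩ := intermediate_value_Icc' (by linarith) (hcont hs₁')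
    ⟨hψ1, heq ▸ hψ.le⟩
  obtain ⟨z₂, hz₂, hz₂ψ⟩ := intermediate_value_Icc (by linarith) (hcont hs₂') ⟨hψ2, hψ.le⟩
  obtain ⟨z₃, hz₃, hz₃ψ⟩ := intermediate_value_Icc' (by linarith) (hcont hs₃') ⟨hψ3, hψ.le⟩
  have hne : z₂ ≠ y₂ := fun h => by rw [h] at hz₂ψ; linarith
  have hlt : z₂ < y₂ := lt_of_le_of_ne hz₂.2 hne
  -- Three pairwise opposite slopes all vanish, whereas the slope at `z₂`, just left of the maximum
  -- `y₂`, is positive.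
  have h12 := hanti z₁ (hs₁' hz₁) z₂ (hs₂' hz₂) (by linarith [hz₁.2, hz₂.1]) (by rw [hz₁ψ, hz₂ψ])
  have h13 := hanti z₁ (hs₁' hz₁) z₃ (hs₃' hz₃) (by linarith [hz₁.2, hz₃.1]) (by rw [hz₁ψ, hz₃ψ])
  have h23 := hanti z₂ (hs₂' hz₂) z₃ (hs₃' hz₃) (by linarith [hz₃.1]) (by rw [hz₂ψ, hz₃ψ])
  have := hpos z₂ ⟨hz₂.1, hlt⟩
  linarith

/-- A solution of the stationary equation for which equal values come with opposite slopes takes no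
value three times, unless it is constant. -/
theorem eq_const_of_three_values {u v : ℝ → ℝ} {I : Set ℝ} {Λ : ℝ} (hI : IsOpen I)
    (hoc : I.OrdConnected) (hu : ∀ x ∈ I, HasDerivAt u (v x) x)
    (hv : ∀ x ∈ I, HasDerivAt v (-((2 * u x ^ 2 + Λ) * u x)) x)
    (hanti : ∀ x ∈ I, ∀ y ∈ I, x < y → u x = u y → v x = -v y)
    {y₁ y₂ y₃ : ℝ} (h₁ : y₁ ∈ I) (h₂ : y₂ ∈ I) (h₃ : y₃ ∈ I) (h₁₂ : y₁ < y₂) (h₂₃ : y₂ < y₃)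
    (he₁₂ : u y₁ = u y₂) (he₂₃ : u y₂ = u y₃) : ∀ x ∈ I, u x = u y₂ := by
  have e12 := hanti y₁ h₁ y₂ h₂ h₁₂ he₁₂
  have e23 := hanti y₂ h₂ y₃ h₃ h₂₃ he₂₃
  have e13 := hanti y₁ h₁ y₃ h₃ (h₁₂.trans h₂₃) (he₁₂.trans he₂₃)
  have hv1 : v y₁ = 0 := by linarith
  have hv2 : v y₂ = 0 := by linarith
  have hd1 := hv y₁ h₁
  have hd2 := hv y₂ h₂
  rw [he₁₂] at hd1
  -- By the equation this number, depending only on the common value of `u`, is the second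
  -- derivative at each of the three points.
  rcases lt_trichotomy (-((2 * u y₂ ^ 2 + Λ) * u y₂)) 0 with hm | hm | hm
  · exact (false_of_two_strict_max hI hu hanti h₁ h₂ h₁₂ he₁₂ hd1 hd2 hm hm hv1 hv2).elim
  · have hcont : ContinuousOn u I := fun x hx => (hu x hx).continuousAt.continuousWithinAt
    -- With `c = u y₂` and `(2c² + Λ)c = 0`, the factorisation of `u³ - c³` gives `(2u² + Λ)u =
    -- (2(u² + uc + c²) + Λ)(u - c)`, so `u - c` solves a linear equation with zero Cauchy data at
    -- `y₂`.
    have := eq_zero_of_second_order hoc (u := fun x => u x - u y₂) (v := v)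
      (w := fun x => 2 * (u x ^ 2 + u x * u y₂ + u y₂ ^ 2) + Λ)
      (fun x hx => (hu x hx).sub_const _)
      (fun x hx => by
        convert hv x hx using 1
        linear_combination -hm)
      (by fun_prop) h₂ (sub_self _) hv2
    exact fun x hx => sub_eq_zero.mp (this x hx)
  -- Two strict minima of `u` are two strict maxima of `-u`.
  · exact (false_of_two_strict_max hI (u := fun x => -u x) (v := fun x => -v x)
      (fun x hx => (hu x hx).fun_neg)
      (fun x hx y hy hxy h => by rw [hanti x hx y hy hxy (neg_inj.mp h)])
      h₁ h₂ h₁₂ (by rw [he₁₂]) hd1.fun_neg hd2.fun_neg (by linarith) (by linarith)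
      (by rw [hv1, neg_zero]) (by rw [hv2, neg_zero])).elim

theorem exists_lt_lt_of_two_lt_encard {s : Set ℝ} (h : 2 < s.encard) :
    ∃ x ∈ s, ∃ y ∈ s, ∃ z ∈ s, x < y ∧ y < z := by
  have h3 : (3 : ℕ∞) ≤ s.encard := by
    have := Order.add_one_le_of_lt h
    rwa [show (2 : ℕ∞) + 1 = 3 by norm_num] at this
  obtain ⟨t, hts, ht⟩ := exists_subset_encard_eq h3
  obtain ⟨x, y, z, hxy, hxz, hyz, rfl⟩ := encard_eq_three.mp ht
  simp only [insert_subset_iff, singleton_subset_iff] at hts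
  obtain ⟨hx, hy, hz⟩ := hts
  rcases lt_or_gt_of_ne hxy with h1 | h1 <;> rcases lt_or_gt_of_ne hxz with h2 | h2 <;>
    rcases lt_or_gt_of_ne hyz with h3 | h3
  · exact ⟨x, hx, y, hy, z, hz, h1, h3⟩
  · exact ⟨x, hx, z, hz, y, hy, h2, h3⟩
  · linarith
  · exact ⟨z, hz, x, hx, y, hy, h2, h1⟩
  · exact ⟨y, hy, x, hx, z, hz, h1, h2⟩
  · linarith
  · exact ⟨y, hy, z, hz, x, hx, h3, h2⟩
  · exact ⟨z, hz, y, hy, x, hx, h3, h1⟩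

namespace MetricGraph

variable {V E H : Type*} {Γ : MetricGraph V E H} [Fintype E] [Fintype H] {q : ℝ}
  {Φ : E ⊕ H → ℝ → ℂ}

/-- Multiplication by the unimodular `c` from the positivity step makes `Φ` real without changing
its modulus, so `Re (cΦ)` solves the real equation. Equality of these real parts is equality of the
complex values, as the reflection argument requires. -/
theorem IsGroundState.encard_le_two (hΓ : Γ.IsConnected) (hq : 0 < q) (hΦ : Γ.IsGroundState q Φ)
    (e : E ⊕ H) (hne : ¬ ∃ a : ℂ, ∀ x ∈ Γ.openEdge e, Φ e x = a) (φ : ℂ) :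
    {x ∈ Γ.openEdge e | Φ e x = φ}.encard ≤ 2 := by
  by_contra! hcon
  obtain ⟨y₁, ⟨h₁, e₁⟩, y₂, ⟨h₂, e₂⟩, y₃, ⟨h₃, e₃⟩, h₁₂, h₂₃⟩ := exists_lt_lt_of_two_lt_encard hcon
  obtain ⟨c, hc, hpos⟩ := hΦ.exists_pos hΓ hq
  obtain ⟨Ψ, G, hG, hs⟩ := hΦ.exists_isClassicalSolution hq
  have hc0 : c ≠ 0 := fun h => by simp [h] at hc
  have hΨΦ {x : ℝ} (hx : x ∈ Γ.openEdge e) : Φ e x = Ψ e x :=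
    hs.eqOn e (Γ.openEdge_subset_closedEdge e hx)
  have hreal {x : ℝ} (hx : x ∈ Γ.openEdge e) : c * Ψ e x = ((c * Ψ e x).re : ℂ) := by
    have := (hpos e x (Γ.openEdge_subset_closedEdge e hx)).1
    rw [hΨΦ hx] at this
    exact Complex.ext (by simp) (by simpa using this)
  have hnorm {x : ℝ} (hx : x ∈ Γ.openEdge e) : ‖Ψ e x‖ ^ 2 = (c * Ψ e x).re ^ 2 := by
    have : ‖c * Ψ e x‖ ^ 2 = (c * Ψ e x).re ^ 2 := by
      rw [hreal hx, Complex.norm_real, Real.norm_eq_abs, sq_abs, Complex.ofReal_re]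
    rwa [norm_mul, hc, one_mul] at this
  have hinj {x y : ℝ} (hx : x ∈ Γ.openEdge e) (hy : y ∈ Γ.openEdge e)
      (h : (c * Ψ e x).re = (c * Ψ e y).re) : Ψ e x = Ψ e y := by
    refine mul_left_cancel₀ hc0 ?_
    rw [hreal hx, hreal hy, h]
  have hre {u : ℝ → ℂ} {w : ℂ} {x : ℝ} (h : HasDerivAt u w x) :
      HasDerivAt (fun y => (c * u y).re) (c * w).re x :=
    Complex.reCLM.hasFDerivAt.comp_hasDerivAt x (h.const_mul c)
  have hval {x : ℝ} (hx : x ∈ Γ.openEdge e) (h : Φ e x = φ) : (c * Ψ e x).re = (c * φ).re := by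
    rw [← hΨΦ hx, h]
  have hconst := eq_const_of_three_values (Γ.isOpen_openEdge e) (Γ.ordConnected_openEdge e)
    (u := fun x => (c * Ψ e x).re) (v := fun x => (c * G e x).re) (Λ := Γ.multiplier q Φ)
    (fun x _ => hre (hs.hasDerivAt e x))
    (fun x hx => by
      convert hre (hs.hasDerivAt_deriv e x (Γ.openEdge_subset_closedEdge e hx)) using 1
      rw [hnorm hx, mul_neg, mul_smul_comm, Complex.neg_re, Complex.smul_re, smul_eq_mul])
    (fun x hx y hy hxy h => by
      rw [hΦ.deriv_eq_neg_deriv hq hG hs hx hy hxy (hinj hx hy h), mul_neg, Complex.neg_re])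
    h₁ h₂ h₃ h₁₂ h₂₃ ((hval h₁ e₁).trans (hval h₂ e₂).symm) ((hval h₂ e₂).trans (hval h₃ e₃).symm)
  exact hne ⟨Ψ e y₂, fun x hx => (hΨΦ hx).trans (hinj hx h₂ (hconst x hx))⟩

end MetricGraph

theorem proposition4p1 {V E H : Type*} [Finite V] [Fintype E] [Fintype H]
    (Γ : MetricGraph V E H) (hΓ : Γ.IsConnected) (q : ℝ) (hq : 0 < q)
    (Φ : E ⊕ H → ℝ → ℂ) (hΦ : Γ.IsGroundState q Φ) :
    (∃ c : ℂ, c ≠ 0 ∧ ∀ e, ∀ x ∈ Γ.closedEdge e, (c * Φ e x).im = 0 ∧ 0 < (c * Φ e x).re) ∧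
    (Γ.MemH2 Φ ∧ ∃ Λ : ℝ, Γ.SolvesStationaryNLS Λ Φ) ∧
    (∀ e, (¬ ∃ a : ℂ, ∀ x ∈ Γ.openEdge e, Φ e x = a) →
      ∀ φ : ℂ, {x ∈ Γ.openEdge e | Φ e x = φ}.encard ≤ 2) := by
  obtain ⟨c, hc, hpos⟩ := hΦ.exists_pos hΓ hq
  exact ⟨⟨c, fun h => by simp [h] at hc, hpos⟩,
    ⟨hΦ.memH2 hq, Γ.multiplier q Φ, hΦ.solvesStationaryNLS hq⟩, hΦ.encard_le_two hΓ hq⟩
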